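/- Let $N\ge 1$ be an integer, and let $m_i\in(0,\infty)$ and $a_i,b_i\in[0,\infty)$ for $i\in[N]:=\{1,\dots,N\}$. The \emph{elastic particle system} is the continuous-time Markov chain $X=(X(t))_{t\ge0}$, $X(t)=(X_1(t),\dots,X_N(t))$, with right-continuous paths, on the ordered configurations $\{x\in\mathbb Z^N: x_1\le\dots\le x_N\}$, started from a deterministic but arbitrary configuration $X(0)$, in which $X_i(t)$ jumps to $X_i(t)-1$ at rate $A_i(X(t))$ and to $X_i(t)+1$ at rate $B_i(X(t))$, where $$A_i(x)=\mathbf 1\{x_{i-1}<x_i\}\sum_{j=i}^N\frac{m_ja_j}{m_i}\mathbf 1\{x_j=x_i\},\qquad B_i(x)=\mathbf 1\{x_{i+1}>x_i\}\sum_{j=1}^i\frac{m_jb_j}{m_i}\mathbf 1\{x_j=x_i\},$$ with the conventions $x_0=-\infty$ and $x_{N+1}=+\infty$. For $k\in[N]$ put $$U_k=-\sum_{i=1}^k m_i(b_i-a_i),\qquad M_k=\sum_{i=1}^k m_i,$$ and let $\Delta_{[N]}(t)=\max_{i}X_i(t)-\min_{i}X_i(t)$. Consider the condition $$\frac{U_k}{M_k}<\frac{U_N}{M_N}\quad\text{for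 all } k\in\{1,\dots,N-1\}.\tag{1}$$ \textbf{Sufficiency.} If (1) holds, then the following are true. (a) For every $i\in[N]$, $\lim_{t\to\infty}t^{-1}X_i(t)=-U_N/M_N$ almost surely. (b) There are constants $C\ge0$ and $\delta>0$, depending only on $N$ and the $a_i,b_i,m_i$ (and not on $X(0)$), such that $$\sup_{t\ge0}\Pr[\Delta_{[N]}(t)\ge s]\le C\bigl[1+e^{C\Delta_{[N]}(0)}\bigr]e^{-\delta s}\quad\text{for all }s\ge0,$$ and, moreover, $\limsup_{t\to\infty}\Delta_{[N]}(t)/\log t<\infty$ almost surely. \textbf{Necessity.} Suppose that $\sum_{i=1}^N(a_i+b_i)>0$. If, for some initial configuration $X(0)$, there are constants $C\ge0$ and $\delta>0$ for which the two assertions of (b) hold for the process started from $X(0)$, then (1) holds. -/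

import Mathlib

open MeasureTheory Filter Topology
open scoped NNReal

noncomputable section

namespace Elastic

/-- `M_k`, the total mass of the first `k` particles (particles are labelled by `Fin N`, so the
first `k` particles are those with `(i : ℕ) < k`). -/
def massSum {N : ℕ} (m : Fin N → ℝ) (k : ℕ) : ℝ :=
  ∑ i : Fin N with i.val < k, m i

/-- `U_k = - ∑_{i ≤ k} m_i u_i`, where `u_i = b_i - a_i` is the intrinsic velocity. -/
def potSum {N : ℕ} (m a b : Fin N → ℝ) (k : ℕ) : ℝ :=
  -∑ i : Fin N with i.val < k, m i * (b i - a i)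

/-- The stability condition: `U_k / M_k < U_N / M_N` for every `1 ≤ k ≤ N - 1`. -/
def StabilityCondition {N : ℕ} (m a b : Fin N → ℝ) : Prop :=
  ∀ k : ℕ, 1 ≤ k → k < N →
    potSum m a b k / massSum m k < potSum m a b N / massSum m N

/-- The rate `A_i(x)` at which particle `i` jumps left: it is nonzero only if
`x_{i-1} < x_i` (no condition for the first particle, by the convention `x_0 = -∞`). -/
def leftRate {N : ℕ} (m a : Fin N → ℝ) (i : Fin N) (x : Fin N → ℤ) : ℝ :=
  open Classical in
  if ∀ j : Fin N, (j : ℕ) + 1 = i → x j < x i then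
    ∑ j : Fin N with i ≤ j ∧ x j = x i, m j * a j / m i
  else 0

/-- The rate `B_i(x)` at which particle `i` jumps right: it is nonzero only if
`x_i < x_{i+1}` (no condition for the last particle, by the convention `x_{N+1} = +∞`). -/
def rightRate {N : ℕ} (m b : Fin N → ℝ) (i : Fin N) (x : Fin N → ℤ) : ℝ :=
  open Classical in
  if ∀ j : Fin N, (j : ℕ) = i + 1 → x i < x j then
    ∑ j : Fin N with j ≤ i ∧ x j = x i, m j * b j / m i
  else 0

/-- The infinitesimal generator of the Markov chain in which coordinate `i` jumps by `-1` at
rate `A_i(x)` and by `+1` at rate `B_i(x)`. -/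
def generator {N : ℕ} (m a b : Fin N → ℝ) (f : (Fin N → ℤ) → ℝ) (x : Fin N → ℤ) : ℝ :=
  ∑ i : Fin N,
    (leftRate m a i x * (f (x - Pi.single i 1) - f x)
      + rightRate m b i x * (f (x + Pi.single i 1) - f x))

/-- `X` is the elastic particle system with masses `m` and jump rates `a` (left), `b` (right),
started from the configuration `x₀`: a continuous-time Markov chain on the ordered
configurations with right-continuous paths and the above generator. As the jump rates are
bounded, this Markov chain is the unique solution of the martingale problem for its generator
on bounded functions, which is how it is specified here. -/
structure IsElasticSystem {N : ℕ} (m a b : Fin N → ℝ) (x₀ : Fin N → ℤ)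
    {Ω : Type*} [MeasurableSpace Ω] (μ : Measure Ω) (X : ℝ≥0 → Ω → Fin N → ℤ) : Prop where
  /-- Each `X t` is a random variable. -/
  stronglyMeasurable : ∀ t, StronglyMeasurable (X t)
  /-- The configuration is always ordered, `X_1(t) ≤ ⋯ ≤ X_N(t)`. -/
  ordered : ∀ t ω, Monotone (X t ω)
  /-- Paths are right-continuous for the discrete topology of the state space. -/
  rightCont : ∀ ω t, ∀ᶠ s in 𝓝[≥] t, X s ω = X t ω
  /-- The initial configuration is deterministic. -/
  init : ∀ ω, X 0 ω = x₀
  /-- For each bounded `f`, `f(X(t)) - ∫_0^t (L f)(X(s)) ds` is a martingale for the filtration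
  generated by `X`. -/
  martingale : ∀ f : (Fin N → ℤ) → ℝ, (∃ K, ∀ x, |f x| ≤ K) →
    Martingale
      (fun t ω => f (X t ω) - ∫ s in (0 : ℝ)..t, generator m a b f (X s.toNNReal ω))
      (Filtration.natural X stronglyMeasurable) μ

/-- The span `Δ_{[N]} = sup_i x_i - inf_i x_i` of a configuration. -/
def span {N : ℕ} [NeZero N] (x : Fin N → ℤ) : ℤ :=
  Finset.univ.sup' Finset.univ_nonempty x - Finset.univ.inf' Finset.univ_nonempty x

/-- `sup_t P[Δ(t) ≥ s] ≤ C (1 + e^{C Δ(0)}) e^{-δ s}` for all `s ≥ 0`. -/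
def ExponentialTails {N : ℕ} [NeZero N] (C δ : ℝ) (x₀ : Fin N → ℤ)
    {Ω : Type*} [MeasurableSpace Ω] (μ : Measure Ω) (X : ℝ≥0 → Ω → Fin N → ℤ) : Prop :=
  ∀ s : ℝ, 0 ≤ s → ∀ t : ℝ≥0,
    μ.real {ω | s ≤ (span (X t ω) : ℝ)} ≤
      C * (1 + Real.exp (C * (span x₀ : ℝ))) * Real.exp (-δ * s)

/-- `limsup_{t → ∞} Δ(t) / log t < ∞` almost surely (the `limsup` is taken in `[-∞, ∞]`). -/
def LogarithmicGrowth {N : ℕ} [NeZero N]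
    {Ω : Type*} [MeasurableSpace Ω] (μ : Measure Ω) (X : ℝ≥0 → Ω → Fin N → ℤ) : Prop :=
  ∀ᵐ ω ∂μ,
    limsup (fun t : ℝ≥0 => (((span (X t ω) : ℝ) / Real.log (t : ℝ) : ℝ) : EReal)) atTop < ⊤

end Elastic

end

/-! At a site occupied by several particles, the leftward momentum `m j * a j` of each particle j
there is handed to the leftmost particle of the cluster, the rightward momentum `m j * b j` to the
rightmost one (`generator_eq`). The rate contains the inverse mass of the carrier, which cancels
against the mass in a mass-weighted observable. Hence the momentum ∑ m_i x_i has the constant drift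
-U_N, and the mass-weighted variance V about the centre of mass x̄ has, up to bounded terms, the
drift 2 ∑ m_j (b_j - a_j)(x_j - x̄) of particles that move independently.

Sufficiency. Relative to the centre of mass the coefficients become m_j (b_j - a_j + U_N/M_N). Their
total is zero and their partial sums are M_k U_N/M_N - U_k, positive exactly under the stability
condition. Summation by parts on an ordered configuration bounds the drift of V by -cΔ + R. Since √V
is comparable to Δ, the function F = exp(θ√(1+V)) satisfies LF ≤ -κF + K for small θ
(`exists_generator_lyapunov_le`). Grönwall and Markov then give tails uniform in time. Doob's
inequality on unit intervals and Borel–Cantelli give exp(δΔ(t)) ≤ (t+1)² eventually, hence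
logarithmic growth. Exponential moments of the momentum, for both signs of the exponent, give its
law of large numbers, and every particle stays within Δ of the centre of mass.

Necessity. Suppose the condition fails at k, and let W = ∑_{i ≤ k} m_i (x_i - x̄). Ordering gives W
≤ 0. The drift of W is also nonpositive: it would be so for independent particles, and passing
momentum to the extreme particles of a cluster only lowers it. So W² has drift at least that of its
quadratic variation, which is bounded below by some q > 0 (`exists_le_generator_block_sq`). Then E
W² ≥ qt, whereas exponential tails bound the second moment of Δ, and with it E W².

The martingale problem speaks of bounded functions only; truncation extends Dynkin's formula to
functions of exponential growth (`dynkin`), which covers F and W². -/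

noncomputable section

namespace Elastic

/-! ### The generator on ordered configurations -/

section

variable {N : ℕ}

/-- In an ordered configuration every particle has a leftmost companion at its site, and the left
jump rates redistribute the momenta `m j * a j` to these companions. -/
lemma exists_leftmost (m a : Fin N → ℝ) {x : Fin N → ℤ} (hx : Monotone x) :
    ∃ l : Fin N → Fin N, (∀ j, l j ≤ j ∧ x (l j) = x j) ∧
      ∀ w : Fin N → ℝ, ∑ i, leftRate m a i x * w i = ∑ j, m j * a j / m (l j) * w (l j) := by
  classical
  -- The three conditions say that j contributes to the left rate of i'. Exactly one particle
  -- satisfies them: in the cluster of j, only the lowest index is not blocked from the left.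
  have key : ∀ j : Fin N, ∃ i : Fin N, ∀ i' : Fin N,
      ((∀ k : Fin N, (k : ℕ) + 1 = i' → x k < x i') ∧ i' ≤ j ∧ x j = x i') ↔ i' = i := by
    intro j
    obtain ⟨i, hi, hmin⟩ := Finset.exists_min_image (Finset.univ.filter fun i => x i = x j) id
      ⟨j, by simp⟩
    simp only [Finset.mem_filter, Finset.mem_univ, true_and, id] at hi hmin
    refine ⟨i, fun i' => ⟨?_, ?_⟩⟩
    · rintro ⟨h1, -, h3⟩
      by_contra hne
      have hlt : i < i' := lt_of_le_of_ne (hmin i' h3.symm) (Ne.symm hne)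
      have hpos : 0 < (i' : ℕ) := lt_of_le_of_lt (Nat.zero_le _) hlt
      have h := h1 ⟨i' - 1, by omega⟩ (by simp; omega)
      have h' : x i ≤ x ⟨i' - 1, by omega⟩ := hx (by
        rw [Fin.le_def]; simp only; have : (i : ℕ) < i' := hlt; omega)
      omega
    · rintro rfl
      refine ⟨fun k hk => ?_, hmin j rfl, hi.symm⟩
      have hki : k < i' := by rw [Fin.lt_def]; omega
      refine lt_of_le_of_ne (hx hki.le) fun h => ?_
      exact absurd (hmin k (h.trans hi)) (not_le.mpr hki)
  choose l hl using key
  refine ⟨l, fun j => ?_, fun w => ?_⟩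
  · have := (hl j (l j)).2 rfl
    exact ⟨this.2.1, this.2.2.symm⟩
  · have e : ∀ i, leftRate m a i x * w i =
        ∑ j, if i = l j then m j * a j / m i * w i else 0 := by
      intro i
      unfold leftRate
      split_ifs with h
      · rw [Finset.sum_filter, Finset.sum_mul]
        refine Finset.sum_congr rfl fun j _ => ?_
        by_cases hij : i = l j
        · have := (hl j i).2 hij
          rw [if_pos ⟨this.2.1, this.2.2⟩, if_pos hij]
        · rw [if_neg hij, if_neg (fun h' => hij ((hl j i).1 ⟨h, h'.1, h'.2⟩)), zero_mul]
      · rw [zero_mul, Finset.sum_eq_zero]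
        intro j _
        rw [if_neg fun hij => h ((hl j i).2 hij).1]
    simp_rw [e]
    rw [Finset.sum_comm]
    simp

/-- The counterpart of `exists_leftmost` for right jumps. -/
lemma exists_rightmost (m b : Fin N → ℝ) {x : Fin N → ℤ} (hx : Monotone x) :
    ∃ r : Fin N → Fin N, (∀ j, j ≤ r j ∧ x (r j) = x j) ∧
      ∀ w : Fin N → ℝ, ∑ i, rightRate m b i x * w i = ∑ j, m j * b j / m (r j) * w (r j) := by
  classical
  have key : ∀ j : Fin N, ∃ i : Fin N, ∀ i' : Fin N,
      ((∀ k : Fin N, (k : ℕ) = i' + 1 → x i' < x k) ∧ j ≤ i' ∧ x j = x i') ↔ i' = i := by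
    intro j
    obtain ⟨i, hi, hmax⟩ := Finset.exists_max_image (Finset.univ.filter fun i => x i = x j) id
      ⟨j, by simp⟩
    simp only [Finset.mem_filter, Finset.mem_univ, true_and, id] at hi hmax
    refine ⟨i, fun i' => ⟨?_, ?_⟩⟩
    · rintro ⟨h1, -, h3⟩
      by_contra hne
      have hlt : i' < i := lt_of_le_of_ne (hmax i' h3.symm) hne
      have hlt' : (i' : ℕ) < i := hlt
      have h := h1 ⟨i' + 1, by omega⟩ rfl
      have h' : x ⟨i' + 1, by omega⟩ ≤ x i := hx (by rw [Fin.le_def]; simp only; omega)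
      omega
    · rintro rfl
      refine ⟨fun k hk => ?_, hmax j rfl, hi.symm⟩
      have hki : i' < k := by rw [Fin.lt_def]; omega
      refine lt_of_le_of_ne (hx hki.le) fun h => ?_
      exact absurd (hmax k (h.symm.trans hi)) (not_le.mpr hki)
  choose r hr using key
  refine ⟨r, fun j => ?_, fun w => ?_⟩
  · have := (hr j (r j)).2 rfl
    exact ⟨this.2.1, this.2.2.symm⟩
  · have e : ∀ i, rightRate m b i x * w i =
        ∑ j, if i = r j then m j * b j / m i * w i else 0 := by
      intro i
      unfold rightRate
      split_ifs with h
      · rw [Finset.sum_filter, Finset.sum_mul]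
        refine Finset.sum_congr rfl fun j _ => ?_
        by_cases hij : i = r j
        · have := (hr j i).2 hij
          rw [if_pos ⟨this.2.1, this.2.2⟩, if_pos hij]
        · rw [if_neg hij, if_neg (fun h' => hij ((hr j i).1 ⟨h, h'.1, h'.2⟩)), zero_mul]
      · rw [zero_mul, Finset.sum_eq_zero]
        intro j _
        rw [if_neg fun hij => h ((hr j i).2 hij).1]
    simp_rw [e]
    rw [Finset.sum_comm]
    simp

/-- On an ordered configuration the generator is a sum over particles `j`, in which the momentum
of `j` is carried by the extreme particles `l j`, `r j` of the cluster of `j`. -/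
lemma generator_eq (m a b : Fin N → ℝ) {x : Fin N → ℤ} (hx : Monotone x) :
    ∃ l r : Fin N → Fin N, (∀ j, l j ≤ j ∧ x (l j) = x j) ∧ (∀ j, j ≤ r j ∧ x (r j) = x j) ∧
      ∀ f : (Fin N → ℤ) → ℝ, generator m a b f x =
        ∑ j, (m j * a j / m (l j) * (f (x - Pi.single (l j) 1) - f x)
          + m j * b j / m (r j) * (f (x + Pi.single (r j) 1) - f x)) := by
  obtain ⟨l, hl, hl'⟩ := exists_leftmost m a hx
  obtain ⟨r, hr, hr'⟩ := exists_rightmost m b hx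
  refine ⟨l, r, hl, hr, fun f => ?_⟩
  unfold generator
  rw [Finset.sum_add_distrib, Finset.sum_add_distrib]
  exact congrArg₂ (· + ·) (hl' fun i => f (x - Pi.single i 1) - f x)
    (hr' fun i => f (x + Pi.single i 1) - f x)

lemma leftRate_nonneg {m a : Fin N → ℝ} (hm : ∀ i, 0 < m i) (ha : ∀ i, 0 ≤ a i) (i : Fin N)
    (x : Fin N → ℤ) : 0 ≤ leftRate m a i x := by
  unfold leftRate
  split_ifs
  · exact Finset.sum_nonneg fun j _ => div_nonneg (mul_nonneg (hm j).le (ha j)) (hm i).le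
  · exact le_rfl

lemma rightRate_nonneg {m b : Fin N → ℝ} (hm : ∀ i, 0 < m i) (hb : ∀ i, 0 ≤ b i) (i : Fin N)
    (x : Fin N → ℤ) : 0 ≤ rightRate m b i x := by
  unfold rightRate
  split_ifs
  · exact Finset.sum_nonneg fun j _ => div_nonneg (mul_nonneg (hm j).le (hb j)) (hm i).le
  · exact le_rfl

lemma leftRate_le {m a : Fin N → ℝ} (hm : ∀ i, 0 < m i) (ha : ∀ i, 0 ≤ a i) (i : Fin N)
    (x : Fin N → ℤ) : leftRate m a i x ≤ ∑ j, m j * a j / m i := by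
  have h : ∀ j, 0 ≤ m j * a j / m i := fun j => div_nonneg (mul_nonneg (hm j).le (ha j)) (hm i).le
  unfold leftRate
  split_ifs
  · exact Finset.sum_le_sum_of_subset_of_nonneg (Finset.subset_univ _) fun j _ _ => h j
  · exact Finset.sum_nonneg fun j _ => h j

lemma rightRate_le {m b : Fin N → ℝ} (hm : ∀ i, 0 < m i) (hb : ∀ i, 0 ≤ b i) (i : Fin N)
    (x : Fin N → ℤ) : rightRate m b i x ≤ ∑ j, m j * b j / m i := by
  have h : ∀ j, 0 ≤ m j * b j / m i := fun j => div_nonneg (mul_nonneg (hm j).le (hb j)) (hm i).le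
  unfold rightRate
  split_ifs
  · exact Finset.sum_le_sum_of_subset_of_nonneg (Finset.subset_univ _) fun j _ _ => h j
  · exact Finset.sum_nonneg fun j _ => h j

/-- A bound for the total jump rate. -/
def rateBound (m a b : Fin N → ℝ) : ℝ :=
  ∑ i, (∑ j, m j * a j / m i + ∑ j, m j * b j / m i)

lemma rateBound_nonneg {m a b : Fin N → ℝ} (hm : ∀ i, 0 < m i) (ha : ∀ i, 0 ≤ a i)
    (hb : ∀ i, 0 ≤ b i) : 0 ≤ rateBound m a b :=
  Finset.sum_nonneg fun i _ => add_nonneg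
    (Finset.sum_nonneg fun j _ => div_nonneg (mul_nonneg (hm j).le (ha j)) (hm i).le)
    (Finset.sum_nonneg fun j _ => div_nonneg (mul_nonneg (hm j).le (hb j)) (hm i).le)

/-- If the increments of `f` at `x` are at most `D ≥ 0`, then so is `L f` up to the jump rate. -/
lemma generator_le_of_increment_le {m a b : Fin N → ℝ} (hm : ∀ i, 0 < m i) (ha : ∀ i, 0 ≤ a i)
    (hb : ∀ i, 0 ≤ b i) {f : (Fin N → ℤ) → ℝ} {x : Fin N → ℤ} {D : ℝ} (hD : 0 ≤ D)
    (h1 : ∀ i, f (x - Pi.single i 1) - f x ≤ D) (h2 : ∀ i, f (x + Pi.single i 1) - f x ≤ D) :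
    generator m a b f x ≤ rateBound m a b * D := by
  unfold generator rateBound
  rw [Finset.sum_mul]
  refine Finset.sum_le_sum fun i _ => ?_
  rw [add_mul]
  refine add_le_add ?_ ?_
  · exact (mul_le_mul_of_nonneg_left (h1 i) (leftRate_nonneg hm ha i x)).trans
      (mul_le_mul_of_nonneg_right (leftRate_le hm ha i x) hD)
  · exact (mul_le_mul_of_nonneg_left (h2 i) (rightRate_nonneg hm hb i x)).trans
      (mul_le_mul_of_nonneg_right (rightRate_le hm hb i x) hD)

lemma generator_neg (m a b : Fin N → ℝ) (f : (Fin N → ℤ) → ℝ) (x : Fin N → ℤ) :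
    generator m a b (fun y => -f y) x = -generator m a b f x := by
  unfold generator
  rw [← Finset.sum_neg_distrib]
  exact Finset.sum_congr rfl fun i _ => by ring

lemma abs_generator_le {m a b : Fin N → ℝ} (hm : ∀ i, 0 < m i) (ha : ∀ i, 0 ≤ a i)
    (hb : ∀ i, 0 ≤ b i) {f : (Fin N → ℤ) → ℝ} {x : Fin N → ℤ} {D : ℝ} (hD : 0 ≤ D)
    (h1 : ∀ i, |f (x - Pi.single i 1) - f x| ≤ D) (h2 : ∀ i, |f (x + Pi.single i 1) - f x| ≤ D) :
    |generator m a b f x| ≤ rateBound m a b * D := by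
  refine abs_le'.2 ⟨generator_le_of_increment_le hm ha hb hD (fun i => (le_abs_self _).trans (h1 i))
    fun i => (le_abs_self _).trans (h2 i), ?_⟩
  rw [← generator_neg]
  refine generator_le_of_increment_le hm ha hb hD (fun i => ?_) fun i => ?_
  · have := neg_abs_le (f (x - Pi.single i 1) - f x); linarith [h1 i]
  · have := neg_abs_le (f (x + Pi.single i 1) - f x); linarith [h2 i]

/-- Truncation at a level above `f x` does not increase `L f`, and above the truncation level
`L` is nonpositive. -/
lemma generator_min_le {m a b : Fin N → ℝ} (hm : ∀ i, 0 < m i) (ha : ∀ i, 0 ≤ a i)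
    (hb : ∀ i, 0 ≤ b i) (f : (Fin N → ℤ) → ℝ) (c : ℝ) (x : Fin N → ℤ) :
    generator m a b (fun y => min (f y) c) x ≤ if f x ≤ c then generator m a b f x else 0 := by
  unfold generator
  split_ifs with h
  · simp only [min_eq_left h]
    refine Finset.sum_le_sum fun i _ => add_le_add ?_ ?_
    · exact mul_le_mul_of_nonneg_left (sub_le_sub_right (min_le_left _ _) _)
        (leftRate_nonneg hm ha i x)
    · exact mul_le_mul_of_nonneg_left (sub_le_sub_right (min_le_left _ _) _)
        (rightRate_nonneg hm hb i x)
  · simp only [min_eq_right (not_le.1 h).le]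
    refine Finset.sum_nonpos fun i _ => add_nonpos ?_ ?_
    · exact mul_nonpos_of_nonneg_of_nonpos (leftRate_nonneg hm ha i x)
        (sub_nonpos.2 (min_le_right _ _))
    · exact mul_nonpos_of_nonneg_of_nonpos (rightRate_nonneg hm hb i x)
        (sub_nonpos.2 (min_le_right _ _))

lemma generator_sub_mul (m a b : Fin N → ℝ) (f g : (Fin N → ℤ) → ℝ) (α : ℝ) (x : Fin N → ℤ) :
    generator m a b (fun y => f y - α * g y) x =
      generator m a b f x - α * generator m a b g x := by
  unfold generator
  rw [Finset.mul_sum, ← Finset.sum_sub_distrib]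
  exact Finset.sum_congr rfl fun i _ => by ring

/-- If the increments of `f` at `x` are dominated by `α` times those of `g`, up to `D ≥ 0`, then
`L f x ≤ α * L g x + O(D)`. -/
lemma generator_le_of_increment_le_mul {m a b : Fin N → ℝ} (hm : ∀ i, 0 < m i)
    (ha : ∀ i, 0 ≤ a i) (hb : ∀ i, 0 ≤ b i) {f g : (Fin N → ℤ) → ℝ} {x : Fin N → ℤ} {α D : ℝ}
    (hD : 0 ≤ D)
    (h1 : ∀ i, f (x - Pi.single i 1) - f x ≤ α * (g (x - Pi.single i 1) - g x) + D)
    (h2 : ∀ i, f (x + Pi.single i 1) - f x ≤ α * (g (x + Pi.single i 1) - g x) + D) :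
    generator m a b f x ≤ α * generator m a b g x + rateBound m a b * D := by
  have h := generator_le_of_increment_le (f := fun y => f y - α * g y) hm ha hb hD
    (fun i => by have := h1 i; linarith) (fun i => by have := h2 i; linarith)
  rw [generator_sub_mul] at h
  linarith

/-! ### Linear functions and the drift of the momentum -/

/-- The linear function of a configuration with coefficients `c`. -/
def wsum (c : Fin N → ℝ) (x : Fin N → ℤ) : ℝ := ∑ i, c i * (x i : ℝ)

lemma wsum_add_single (c : Fin N → ℝ) (x : Fin N → ℤ) (i : Fin N) :
    wsum c (x + Pi.single i 1) = wsum c x + c i := by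
  unfold wsum
  have : ∀ j, c j * (((x + Pi.single i 1 : Fin N → ℤ) j : ℤ) : ℝ) =
      c j * (x j : ℝ) + if j = i then c i else 0 := by
    intro j
    by_cases h : j = i
    · subst h; simp; ring
    · simp [h]
  simp_rw [this]
  rw [Finset.sum_add_distrib]
  simp

lemma wsum_sub_single (c : Fin N → ℝ) (x : Fin N → ℤ) (i : Fin N) :
    wsum c (x - Pi.single i 1) = wsum c x - c i := by
  have := wsum_add_single c (x - Pi.single i 1) i
  rw [sub_add_cancel] at this
  linarith

lemma massSum_all (m : Fin N → ℝ) : massSum m N = ∑ i, m i := by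
  unfold massSum
  congr 1
  ext i; simp

lemma potSum_all (m a b : Fin N → ℝ) : potSum m a b N = -∑ i, m i * (b i - a i) := by
  unfold potSum
  congr 2
  ext i; simp

lemma massSum_pos [NeZero N] {m : Fin N → ℝ} (hm : ∀ i, 0 < m i) : 0 < massSum m N := by
  rw [massSum_all]
  exact Finset.sum_pos (fun i _ => hm i) Finset.univ_nonempty

lemma mass_le_massSum {m : Fin N → ℝ} (hm : ∀ i, 0 < m i) (i : Fin N) : m i ≤ massSum m N := by
  rw [massSum_all]
  exact Finset.single_le_sum (f := m) (fun j _ => (hm j).le) (Finset.mem_univ i)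

/-- The momentum `∑ m i * x i` has constant drift. -/
lemma generator_wsum_mass {m a b : Fin N → ℝ} (hm : ∀ i, 0 < m i) {x : Fin N → ℤ}
    (hx : Monotone x) : generator m a b (wsum m) x = -potSum m a b N := by
  obtain ⟨l, r, -, -, h⟩ := generator_eq m a b hx
  rw [h, potSum_all, neg_neg]
  refine Finset.sum_congr rfl fun j _ => ?_
  rw [wsum_sub_single, wsum_add_single]
  have h1 := (hm (l j)).ne'
  have h2 := (hm (r j)).ne'
  field_simp
  ring

/-- Linearising the exponential keeps the first-order term with its sign, so a drift survives
exponentiation at the price of the quadratic error `D ^ 2`. -/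
lemma exp_sub_exp_le {y d D : ℝ} (hd : |d| ≤ D) (hD : D ≤ 1) :
    Real.exp (y + d) - Real.exp y ≤ Real.exp y * (d + D ^ 2) := by
  have h := (abs_le.1 (Real.abs_exp_sub_one_sub_id_le (hd.trans hD))).2
  have h2 : d ^ 2 ≤ D ^ 2 := sq_le_sq' (by linarith [(abs_le.1 hd).1]) (abs_le.1 hd).2
  rw [Real.exp_add, ← mul_sub_one]
  exact mul_le_mul_of_nonneg_left (by linarith) (Real.exp_pos y).le

/-- Exponential functions of the momentum grow at the rate predicted by the drift, up to a
quadratic error. -/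
lemma generator_exp_wsum_le {m a b : Fin N → ℝ} (hm : ∀ i, 0 < m i)
    (ha : ∀ i, 0 ≤ a i) (hb : ∀ i, 0 ≤ b i) {θ B : ℝ} (hB : ∀ i, m i ≤ B) (hθ : |θ| * B ≤ 1)
    {x : Fin N → ℤ} (hx : Monotone x) :
    generator m a b (fun y => Real.exp (θ * wsum m y)) x ≤
      (-θ * potSum m a b N + rateBound m a b * (|θ| * B) ^ 2) * Real.exp (θ * wsum m x) := by
  have hd : ∀ i, |θ * m i| ≤ |θ| * B := fun i => by
    rw [abs_mul, abs_of_pos (hm i)]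
    exact mul_le_mul_of_nonneg_left (hB i) (abs_nonneg θ)
  have h := generator_le_of_increment_le_mul hm ha hb (f := fun y => Real.exp (θ * wsum m y))
    (g := wsum m) (x := x) (α := Real.exp (θ * wsum m x) * θ)
    (D := Real.exp (θ * wsum m x) * (|θ| * B) ^ 2) (by positivity)
    (fun i => by
      have := exp_sub_exp_le (y := θ * wsum m x) (d := -(θ * m i)) (by rw [abs_neg]; exact hd i) hθ
      simp only [wsum_sub_single]
      rw [mul_sub, sub_eq_add_neg (θ * wsum m x)]
      linarith)
    (fun i => by
      have := exp_sub_exp_le (y := θ * wsum m x) (hd i) hθ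
      simp only [wsum_add_single]
      rw [mul_add]
      linarith)
  rw [generator_wsum_mass hm hx] at h
  linarith

/-! ### Variance and span -/

/-- The mass-weighted quadratic deviation of a configuration from its centre of mass. -/
def variance (m : Fin N → ℝ) (x : Fin N → ℤ) : ℝ :=
  ∑ i, m i * ((x i : ℝ) - wsum m x / massSum m N) ^ 2

lemma variance_eq [NeZero N] {m : Fin N → ℝ} (hm : ∀ i, 0 < m i) (x : Fin N → ℤ) :
    variance m x = ∑ i, m i * (x i : ℝ) ^ 2 - wsum m x ^ 2 / massSum m N := by
  have hM := (massSum_pos hm).ne'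
  have : ∀ i, m i * ((x i : ℝ) - wsum m x / massSum m N) ^ 2 = m i * (x i : ℝ) ^ 2
      - 2 * (wsum m x / massSum m N) * (m i * x i) + (wsum m x / massSum m N) ^ 2 * m i :=
    fun i => by ring
  unfold variance
  simp_rw [this]
  rw [Finset.sum_add_distrib, Finset.sum_sub_distrib, ← Finset.mul_sum, ← Finset.mul_sum,
    ← massSum_all m]
  change _ - 2 * (wsum m x / massSum m N) * wsum m x + _ = _
  field_simp
  ring

lemma sum_sq_add_single (m : Fin N → ℝ) (x : Fin N → ℤ) (i : Fin N) :
    ∑ j, m j * (((x + Pi.single i 1 : Fin N → ℤ) j : ℤ) : ℝ) ^ 2 =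
      ∑ j, m j * (x j : ℝ) ^ 2 + m i * (2 * x i + 1) := by
  have : ∀ j, m j * (((x + Pi.single i 1 : Fin N → ℤ) j : ℤ) : ℝ) ^ 2 =
      m j * (x j : ℝ) ^ 2 + if j = i then m i * (2 * x i + 1) else 0 := by
    intro j
    by_cases h : j = i
    · subst h; simp; ring
    · simp [h]
  simp_rw [this]
  rw [Finset.sum_add_distrib]
  simp

/-- The increment is exact. The correction `1 - m i / massSum m N` lies in [0, 1]; its subtracted
part comes from the centre of mass moving along with the particle. -/
lemma variance_add_single [NeZero N] {m : Fin N → ℝ} (hm : ∀ i, 0 < m i) (x : Fin N → ℤ)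
    (i : Fin N) : variance m (x + Pi.single i 1) =
      variance m x + m i * (2 * ((x i : ℝ) - wsum m x / massSum m N) + (1 - m i / massSum m N)) := by
  rw [variance_eq hm, variance_eq hm, sum_sq_add_single, wsum_add_single]
  have hM := (massSum_pos hm).ne'
  field_simp
  ring

lemma variance_sub_single [NeZero N] {m : Fin N → ℝ} (hm : ∀ i, 0 < m i) (x : Fin N → ℤ)
    (i : Fin N) : variance m (x - Pi.single i 1) =
      variance m x + m i * (-2 * ((x i : ℝ) - wsum m x / massSum m N) + (1 - m i / massSum m N)) := by
  have h := variance_add_single hm (x - Pi.single i 1) i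
  rw [sub_add_cancel, wsum_sub_single] at h
  have h2 : (((x - Pi.single i 1 : Fin N → ℤ) i : ℤ) : ℝ) = x i - 1 := by simp
  rw [h2] at h
  have hM := (massSum_pos hm).ne'
  rw [h]
  field_simp
  ring

lemma variance_nonneg {m : Fin N → ℝ} (hm : ∀ i, 0 < m i) (x : Fin N → ℤ) : 0 ≤ variance m x :=
  Finset.sum_nonneg fun i _ => mul_nonneg (hm i).le (sq_nonneg _)

lemma mul_dev_sq_le_variance {m : Fin N → ℝ} (hm : ∀ i, 0 < m i) (x : Fin N → ℤ) (i : Fin N) :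
    m i * ((x i : ℝ) - wsum m x / massSum m N) ^ 2 ≤ variance m x :=
  Finset.single_le_sum (f := fun i => m i * ((x i : ℝ) - wsum m x / massSum m N) ^ 2)
    (fun j _ => mul_nonneg (hm j).le (sq_nonneg _)) (Finset.mem_univ i)

lemma sub_le_span [NeZero N] (x : Fin N → ℤ) (i j : Fin N) : x i - x j ≤ span x := by
  unfold span
  have h1 := Finset.le_sup' x (Finset.mem_univ i)
  have h2 := Finset.inf'_le x (Finset.mem_univ j)
  omega

lemma exists_span_eq [NeZero N] (x : Fin N → ℤ) : ∃ i j, span x = x i - x j := by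
  obtain ⟨i, -, hi⟩ := Finset.exists_mem_eq_sup' Finset.univ_nonempty x
  obtain ⟨j, -, hj⟩ := Finset.exists_mem_eq_inf' Finset.univ_nonempty x
  exact ⟨i, j, by rw [span, hi, hj]⟩

lemma span_nonneg [NeZero N] (x : Fin N → ℤ) : 0 ≤ span x := by
  simpa using sub_le_span x 0 0

/-- Every particle is within distance `span x` of the centre of mass. -/
lemma abs_sub_center_le [NeZero N] {m : Fin N → ℝ} (hm : ∀ i, 0 < m i) (x : Fin N → ℤ)
    (i : Fin N) : |(x i : ℝ) - wsum m x / massSum m N| ≤ span x := by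
  have hM := massSum_pos hm
  have e : (x i : ℝ) - wsum m x / massSum m N =
      (∑ j, m j * ((x i : ℝ) - x j)) / massSum m N := by
    rw [eq_div_iff hM.ne', sub_mul, div_mul_cancel₀ _ hM.ne', massSum_all, Finset.mul_sum, wsum,
      ← Finset.sum_sub_distrib]
    exact Finset.sum_congr rfl fun j _ => by ring
  rw [e, abs_div, abs_of_pos hM, div_le_iff₀ hM]
  refine (Finset.abs_sum_le_sum_abs _ _).trans ?_
  rw [massSum_all, Finset.mul_sum]
  refine Finset.sum_le_sum fun j _ => ?_
  rw [abs_mul, abs_of_pos (hm j), mul_comm]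
  refine mul_le_mul_of_nonneg_right ?_ (hm j).le
  have h1 := sub_le_span x i j
  have h2 := sub_le_span x j i
  rw [abs_le]
  constructor
  · have : ((x j - x i : ℤ) : ℝ) ≤ span x := by exact_mod_cast h2
    push_cast at this; linarith
  · have : ((x i - x j : ℤ) : ℝ) ≤ span x := by exact_mod_cast h1
    push_cast at this; linarith

lemma variance_le_span_sq [NeZero N] {m : Fin N → ℝ} (hm : ∀ i, 0 < m i) (x : Fin N → ℤ) :
    variance m x ≤ massSum m N * (span x : ℝ) ^ 2 := by
  rw [massSum_all, Finset.sum_mul]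
  refine Finset.sum_le_sum fun i _ => mul_le_mul_of_nonneg_left ?_ (hm i).le
  have h := abs_sub_center_le hm x i
  rw [← sq_abs]
  gcongr

/-- The span is a difference p - q of two deviations from the centre, (p - q)² ≤ 2p² + 2q², and each
of c p², c q² is at most the variance. -/
lemma span_sq_le_variance [NeZero N] {m : Fin N → ℝ} (hm : ∀ i, 0 < m i) {c : ℝ}
    (hc : 0 < c) (hcm : ∀ i, c ≤ m i) (x : Fin N → ℤ) :
    c / 4 * (span x : ℝ) ^ 2 ≤ variance m x := by
  obtain ⟨i, j, h⟩ := exists_span_eq x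
  have key : ∀ i, c * ((x i : ℝ) - wsum m x / massSum m N) ^ 2 ≤ variance m x := fun i =>
    (mul_le_mul_of_nonneg_right (hcm i) (sq_nonneg _)).trans (mul_dev_sq_le_variance hm x i)
  have e : (span x : ℝ) = ((x i : ℝ) - wsum m x / massSum m N) -
      ((x j : ℝ) - wsum m x / massSum m N) := by rw [h]; push_cast; ring
  rw [e]
  have h1 := key i
  have h2 := key j
  set p := (x i : ℝ) - wsum m x / massSum m N
  set q := (x j : ℝ) - wsum m x / massSum m N
  nlinarith [mul_nonneg hc.le (sq_nonneg (p + q))]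

/-- Summation by parts: if the partial sums of `e` are at least `c`, except that the total sum
vanishes, then `∑ e i * x i ≤ -c * span x` on ordered configurations. -/
lemma sum_mul_le_neg_span [NeZero N] {e : Fin N → ℝ} {c : ℝ} (he : ∑ i, e i = 0)
    (hc : ∀ k : ℕ, 1 ≤ k → k < N → c ≤ ∑ i : Fin N with i.val < k, e i)
    {x : Fin N → ℤ} (hx : Monotone x) : ∑ i, e i * (x i : ℝ) ≤ -c * span x := by
  have hN : 0 < N := Nat.pos_of_ne_zero (NeZero.ne N)
  -- Both sequences are extended by zero to ℕ, where summation by parts over `Finset.range` applies.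
  -- The boundary term vanishes because the total of `e` is zero, and the increments of `y`
  -- telescope to the span.
  set E : ℕ → ℝ := fun i => if h : i < N then e ⟨i, h⟩ else 0 with hE
  set y : ℕ → ℝ := fun i => if h : i < N then (x ⟨i, h⟩ : ℝ) else 0 with hy
  have hEk : ∀ k ≤ N, ∑ i : Fin N with i.val < k, e i = ∑ i ∈ Finset.range k, E i := by
    intro k hk
    have : ∑ i ∈ Finset.range k, E i = ∑ i ∈ (Finset.range N).filter (· < k), E i := by
      congr 1; ext i; simp; omega
    rw [this, Finset.sum_filter, Finset.sum_filter,
      ← Fin.sum_univ_eq_sum_range (fun i => if i < k then E i else 0)]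
    refine Finset.sum_congr rfl fun i _ => ?_
    simp [hE]
  have hE0 : ∑ i ∈ Finset.range N, E i = 0 := by
    rw [← hEk N le_rfl, ← he]
    congr 1; ext i; simp
  have e1 : ∑ i, e i * (x i : ℝ) = ∑ i ∈ Finset.range N, y i • E i := by
    rw [← Fin.sum_univ_eq_sum_range (fun i => y i • E i)]
    refine Finset.sum_congr rfl fun i _ => ?_
    simp [hE, hy, mul_comm]
  have hspan : (span x : ℝ) = y (N - 1) - y 0 := by
    have h0 : y 0 = x ⟨0, hN⟩ := by simp [hy, hN]
    have h1 : y (N - 1) = x ⟨N - 1, by omega⟩ := by simp [hy, hN]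
    rw [h0, h1]
    obtain ⟨i, j, hij⟩ := exists_span_eq x
    have h2 := sub_le_span x ⟨N - 1, by omega⟩ ⟨0, hN⟩
    have h3 : x i ≤ x ⟨N - 1, by omega⟩ := hx (by rw [Fin.le_def]; simp only; omega)
    have h4 : x ⟨0, hN⟩ ≤ x j := hx (by rw [Fin.le_def]; simp)
    have : span x = x ⟨N - 1, by omega⟩ - x ⟨0, hN⟩ := by omega
    rw [this]; push_cast; ring
  rw [e1, Finset.sum_range_by_parts, hE0, smul_zero, zero_sub, hspan, neg_mul,
    ← Finset.sum_range_sub, Finset.mul_sum]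
  refine neg_le_neg (Finset.sum_le_sum fun i hi => ?_)
  have hi' : i + 1 < N := by have := Finset.mem_range.1 hi; omega
  rw [smul_eq_mul, mul_comm]
  refine mul_le_mul_of_nonneg_left ?_ ?_
  · rw [← hEk _ hi'.le]
    exact hc (i + 1) (by omega) hi'
  · have : y i ≤ y (i + 1) := by
      simp only [hy, hi', show i < N by omega, dif_pos]
      exact_mod_cast hx (by rw [Fin.le_def]; simp)
    linarith

lemma exists_pos_le_of_forall_pos {ι : Type*} (s : Finset ι) (f : ι → ℝ) (hf : ∀ i ∈ s, 0 < f i) :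
    ∃ c, 0 < c ∧ ∀ i ∈ s, c ≤ f i := by
  rcases s.eq_empty_or_nonempty with rfl | hs
  · exact ⟨1, one_pos, by simp⟩
  · obtain ⟨i, hi, h⟩ := s.exists_min_image f hs
    exact ⟨f i, hf i hi, h⟩

/-- Under the stability condition the quadratic deviation has drift at most `-c Δ + R`. -/
lemma exists_generator_variance_le [NeZero N] {m a b : Fin N → ℝ} (hm : ∀ i, 0 < m i)
    (ha : ∀ i, 0 ≤ a i) (hb : ∀ i, 0 ≤ b i) (h : StabilityCondition m a b) :
    ∃ c R : ℝ, 0 < c ∧ 0 ≤ R ∧ ∀ x : Fin N → ℤ, Monotone x →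
      generator m a b (variance m) x ≤ -c * span x + R := by
  have hM := massSum_pos hm
  set u := potSum m a b N / massSum m N with hu
  -- Momentum of particle i seen from the frame of the centre of mass, whose velocity is `-u`. The
  -- stability condition says that the proper partial sums of `e` are positive.
  set e : Fin N → ℝ := fun i => m i * (b i - a i) + m i * u with he
  have hek : ∀ k : ℕ, ∑ i : Fin N with i.val < k, e i = -potSum m a b k + massSum m k * u := by
    intro k
    simp only [he]
    rw [Finset.sum_add_distrib, ← Finset.sum_mul, potSum, neg_neg]
    rfl
  have he0 : ∑ i, e i = 0 := by
    have : ∑ i, e i = ∑ i : Fin N with i.val < N, e i := by congr 1; ext i; simp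
    rw [this, hek, hu]
    field_simp
    ring
  obtain ⟨c, hc, hc'⟩ := exists_pos_le_of_forall_pos (Finset.Ico 1 N)
    (fun k => ∑ i : Fin N with i.val < k, e i) (fun k hk => by
      rw [Finset.mem_Ico] at hk
      have hMk : 0 < massSum m k := Finset.sum_pos (fun i _ => hm i)
        ⟨⟨0, by omega⟩, by simp; omega⟩
      have := h k hk.1 hk.2
      rw [div_lt_iff₀ hMk] at this
      rw [hek]
      linarith [mul_comm u (massSum m k)])
  refine ⟨2 * c, ∑ j, m j * (a j + b j), by positivity,
    Finset.sum_nonneg fun j _ => mul_nonneg (hm j).le (add_nonneg (ha j) (hb j)), fun x hx => ?_⟩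
  have hAbel := sum_mul_le_neg_span he0
    (fun k h1 h2 => hc' k (Finset.mem_Ico.2 ⟨h1, h2⟩)) hx
  obtain ⟨l, r, hl, hr, hgen⟩ := generator_eq m a b hx
  rw [hgen]
  set xb := wsum m x / massSum m N with hxb
  -- The carrier shares the site of j, so its deviation equals that of j and its mass cancels the
  -- inverse mass in the rate. The terms with `m (l j) / massSum m N` and `m (r j) / massSum m N`
  -- enter negatively and are dropped.
  have hbd : ∀ j, m j * a j / m (l j) * (variance m (x - Pi.single (l j) 1) - variance m x)
      + m j * b j / m (r j) * (variance m (x + Pi.single (r j) 1) - variance m x) ≤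
      2 * (m j * (b j - a j) * (x j - xb)) + m j * (a j + b j) := by
    intro j
    rw [variance_sub_single hm, variance_add_single hm, (hl j).2, (hr j).2, ← hxb]
    have h1 := hm (l j)
    have h2 := hm (r j)
    have e1 : m j * a j / m (l j) * (variance m x + m (l j) * (-2 * ((x j : ℝ) - xb) +
        (1 - m (l j) / massSum m N)) - variance m x) = m j * a j * (-2 * ((x j : ℝ) - xb) +
        (1 - m (l j) / massSum m N)) := by field_simp; ring
    have e2 : m j * b j / m (r j) * (variance m x + m (r j) * (2 * ((x j : ℝ) - xb) +
        (1 - m (r j) / massSum m N)) - variance m x) = m j * b j * (2 * ((x j : ℝ) - xb) +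
        (1 - m (r j) / massSum m N)) := by field_simp; ring
    rw [e1, e2]
    have g1 : 0 ≤ m j * a j * (m (l j) / massSum m N) :=
      mul_nonneg (mul_nonneg (hm j).le (ha j)) (div_nonneg h1.le hM.le)
    have g2 : 0 ≤ m j * b j * (m (r j) / massSum m N) :=
      mul_nonneg (mul_nonneg (hm j).le (hb j)) (div_nonneg h2.le hM.le)
    linarith
  refine (Finset.sum_le_sum fun j _ => hbd j).trans ?_
  rw [Finset.sum_add_distrib, ← Finset.mul_sum]
  have e3 : ∑ j, m j * (b j - a j) * ((x j : ℝ) - xb) = ∑ j, e j * (x j : ℝ) := by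
    have : ∀ j, m j * (b j - a j) * ((x j : ℝ) - xb) =
        e j * (x j : ℝ) - u * (m j * x j) - (m j * (b j - a j)) * xb := by
      intro j; simp only [he]; ring
    simp_rw [this]
    rw [Finset.sum_sub_distrib, Finset.sum_sub_distrib, ← Finset.mul_sum, ← Finset.sum_mul]
    change _ - u * wsum m x - _ = _
    have hp : ∑ j, m j * (b j - a j) = -potSum m a b N := by rw [potSum_all, neg_neg]
    rw [hp, hu, hxb]
    field_simp
    ring
  rw [e3]
  linarith

/-! ### The exponential Lyapunov function -/

/-- The exponential Lyapunov function `exp (θ √(1 + variance))`. -/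
def lyapunov (m : Fin N → ℝ) (θ : ℝ) (x : Fin N → ℤ) : ℝ :=
  Real.exp (θ * √(1 + variance m x))

lemma lyapunov_le_exp_span [NeZero N] {m : Fin N → ℝ} (hm : ∀ i, 0 < m i) {θ : ℝ} (hθ : 0 ≤ θ)
    (x : Fin N → ℤ) : lyapunov m θ x ≤ Real.exp (θ * (1 + √(massSum m N) * span x)) := by
  have hs : (0 : ℝ) ≤ span x := by exact_mod_cast span_nonneg x
  refine Real.exp_le_exp.2 (mul_le_mul_of_nonneg_left ?_ hθ)
  refine Real.sqrt_le_iff.2 ⟨by positivity, ?_⟩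
  have h := variance_le_span_sq hm x
  have h2 := Real.sq_sqrt (massSum_pos hm).le
  have h3 : 0 ≤ √(massSum m N) * span x := by positivity
  nlinarith

lemma exp_span_le_lyapunov [NeZero N] {m : Fin N → ℝ} (hm : ∀ i, 0 < m i) {c : ℝ}
    (hc : 0 < c) (hcm : ∀ i, c ≤ m i) {θ : ℝ} (hθ : 0 ≤ θ)
    (x : Fin N → ℤ) : Real.exp (θ * (√c / 2) * span x) ≤ lyapunov m θ x := by
  rw [mul_assoc]
  refine Real.exp_le_exp.2 (mul_le_mul_of_nonneg_left ?_ hθ)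
  refine Real.le_sqrt_of_sq_le ?_
  have h := span_sq_le_variance hm hc hcm x
  have h2 := Real.sq_sqrt hc.le
  rw [mul_pow, div_pow, h2]
  linarith

lemma span_le_two_mul_sum_abs [NeZero N] (x : Fin N → ℤ) : (span x : ℝ) ≤ 2 * ∑ i, |(x i : ℝ)| := by
  obtain ⟨i, j, h⟩ := exists_span_eq x
  have key : ∀ i, |(x i : ℝ)| ≤ ∑ i, |(x i : ℝ)| := fun i =>
    Finset.single_le_sum (f := fun i => |(x i : ℝ)|) (fun _ _ => abs_nonneg _) (Finset.mem_univ i)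
  rw [h]
  push_cast
  have h1 := le_abs_self (x i : ℝ)
  have h2 := neg_abs_le (x j : ℝ)
  linarith [key i, key j]

/-- A jump of the variance is of the order of its own square root, so the square root has bounded
jumps. Concavity places it below its tangent line, so an upper bound on the drift of the variance
transfers to the square root. -/
lemma sqrt_sub_sqrt_bounds {q q' J : ℝ} (hq : 0 ≤ q) (hq' : 0 ≤ q') (hJ : 0 ≤ J)
    (h : |q' - q| ≤ J * √(1 + q)) :
    |√(1 + q') - √(1 + q)| ≤ J ∧
      √(1 + q') - √(1 + q) ≤ (2 * √(1 + q))⁻¹ * (q' - q) := by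
  have h1 : √(1 + q) ^ 2 = 1 + q := Real.sq_sqrt (by linarith)
  have h2 : √(1 + q') ^ 2 = 1 + q' := Real.sq_sqrt (by linarith)
  have h3 : 0 < √(1 + q) := Real.sqrt_pos.2 (by linarith)
  have h4 : 0 < √(1 + q') := Real.sqrt_pos.2 (by linarith)
  set s := √(1 + q)
  set t := √(1 + q')
  have e : q' - q = (t - s) * (t + s) := by ring_nf; linarith
  constructor
  · rw [e, abs_mul, abs_of_pos (by positivity : 0 < t + s)] at h
    by_contra hcon
    push Not at hcon
    have : J * s < |t - s| * (t + s) := by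
      calc J * s ≤ |t - s| * s := mul_le_mul_of_nonneg_right hcon.le h3.le
        _ < |t - s| * (t + s) := mul_lt_mul_of_pos_left (by linarith) (by linarith)
    linarith
  · rw [inv_mul_eq_div, le_div_iff₀ (by positivity), e]
    nlinarith [sq_nonneg (t - s)]

/-- The increment is linear in the deviation, and m_i times the deviation is at most `√B` times the
root of the variance. The sign `s` covers jumps in both directions. -/
lemma abs_variance_increment_le [NeZero N] {m : Fin N → ℝ} (hm : ∀ i, 0 < m i) {B : ℝ}
    (hB : ∀ i, m i ≤ B) (x : Fin N → ℤ) (i : Fin N) {s : ℝ} (hs : |s| = 1) :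
    |m i * (2 * s * ((x i : ℝ) - wsum m x / massSum m N) + (1 - m i / massSum m N))| ≤
      (2 * √B + B) * √(1 + variance m x) := by
  have hv := variance_nonneg hm x
  have hM := massSum_pos hm
  have hBpos : 0 < B := (hm i).trans_le (hB i)
  have h1 : 1 ≤ √(1 + variance m x) := Real.one_le_sqrt.2 (by linarith)
  have hmi := mass_le_massSum hm i
  have h2 : |1 - m i / massSum m N| ≤ 1 := by
    have h3 : m i / massSum m N ≤ 1 := (div_le_one hM).2 hmi
    have h4 : 0 ≤ m i / massSum m N := div_nonneg (hm i).le hM.le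
    rw [abs_le]; constructor <;> linarith
  have h3 : m i * |(x i : ℝ) - wsum m x / massSum m N| ≤ √B * √(1 + variance m x) := by
    rw [← Real.sqrt_mul hBpos.le]
    refine Real.le_sqrt_of_sq_le ?_
    rw [mul_pow, sq_abs]
    have h5 := mul_dev_sq_le_variance hm x i
    calc m i ^ 2 * ((x i : ℝ) - wsum m x / massSum m N) ^ 2
        = m i * (m i * ((x i : ℝ) - wsum m x / massSum m N) ^ 2) := by ring
      _ ≤ B * (1 + variance m x) :=
        mul_le_mul (hB i) (by linarith) (mul_nonneg (hm i).le (sq_nonneg _)) hBpos.le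
  calc |m i * (2 * s * ((x i : ℝ) - wsum m x / massSum m N) + (1 - m i / massSum m N))|
      ≤ m i * (2 * |(x i : ℝ) - wsum m x / massSum m N| + |1 - m i / massSum m N|) := by
        rw [abs_mul, abs_of_pos (hm i)]
        refine mul_le_mul_of_nonneg_left ((abs_add_le _ _).trans ?_) (hm i).le
        rw [abs_mul, abs_mul, hs]; simp
    _ = 2 * (m i * |(x i : ℝ) - wsum m x / massSum m N|) + m i * |1 - m i / massSum m N| := by ring
    _ ≤ 2 * (√B * √(1 + variance m x)) + B * √(1 + variance m x) := by
        gcongr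
        · exact hB i
        · linarith
    _ = _ := by ring

/-- The drift of the Lyapunov function in terms of that of the quadratic deviation. -/
lemma generator_lyapunov_le_variance [NeZero N] {m a b : Fin N → ℝ} (hm : ∀ i, 0 < m i)
    (ha : ∀ i, 0 ≤ a i) (hb : ∀ i, 0 ≤ b i) {B : ℝ} (hB : ∀ i, m i ≤ B) {θ : ℝ} (hθ : 0 ≤ θ)
    (hθB : θ * (2 * √B + B) ≤ 1) (x : Fin N → ℤ) :
    generator m a b (lyapunov m θ) x ≤ lyapunov m θ x *
      (θ * (2 * √(1 + variance m x))⁻¹ * generator m a b (variance m) x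
        + rateBound m a b * (θ * (2 * √B + B)) ^ 2) := by
  have hBpos : 0 < B := (hm 0).trans_le (hB 0)
  set J := 2 * √B + B with hJ
  have hJ0 : 0 ≤ J := by positivity
  have key : ∀ y : Fin N → ℤ, |variance m y - variance m x| ≤ J * √(1 + variance m x) →
      lyapunov m θ y - lyapunov m θ x ≤
        lyapunov m θ x * (θ * (2 * √(1 + variance m x))⁻¹) * (variance m y - variance m x)
          + lyapunov m θ x * (θ * J) ^ 2 := by
    intro y hy
    obtain ⟨h1, h2⟩ := sqrt_sub_sqrt_bounds (variance_nonneg hm x) (variance_nonneg hm y) hJ0 hy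
    have h3 := exp_sub_exp_le (y := θ * √(1 + variance m x))
      (d := θ * (√(1 + variance m y) - √(1 + variance m x))) (D := θ * J)
      (by rw [abs_mul, abs_of_nonneg hθ]; exact mul_le_mul_of_nonneg_left h1 hθ) hθB
    rw [← mul_add, add_sub_cancel] at h3
    unfold lyapunov
    refine h3.trans ?_
    rw [mul_add, mul_assoc]
    refine add_le_add_left (mul_le_mul_of_nonneg_left ?_ (Real.exp_pos _).le) _
    rw [mul_assoc]
    exact mul_le_mul_of_nonneg_left h2 hθ
  have h := generator_le_of_increment_le_mul hm ha hb (f := lyapunov m θ) (g := variance m)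
    (x := x) (α := lyapunov m θ x * (θ * (2 * √(1 + variance m x))⁻¹))
    (D := lyapunov m θ x * (θ * J) ^ 2)
    (mul_nonneg (Real.exp_pos _).le (sq_nonneg _))
    (fun i => key _ (by
      rw [variance_sub_single hm, add_sub_cancel_left]
      simpa using abs_variance_increment_le hm hB x i (s := -1) (by simp)))
    (fun i => key _ (by
      rw [variance_add_single hm, add_sub_cancel_left]
      simpa using abs_variance_increment_le hm hB x i (s := 1) (by simp)))
  refine h.trans (le_of_eq ?_)
  ring

/-- Under the stability condition, the exponential function of the deviation satisfies a
geometric drift condition. -/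
lemma exists_generator_lyapunov_le [NeZero N] {m a b : Fin N → ℝ} (hm : ∀ i, 0 < m i)
    (ha : ∀ i, 0 ≤ a i) (hb : ∀ i, 0 ≤ b i) (h : StabilityCondition m a b) :
    ∃ θ κ K : ℝ, 0 < θ ∧ 0 < κ ∧ 0 ≤ K ∧ ∀ x : Fin N → ℤ, Monotone x →
      generator m a b (lyapunov m θ) x ≤ -κ * lyapunov m θ x + K := by
  obtain ⟨c, R, hc, hR, hvar⟩ := exists_generator_variance_le hm ha hb h
  have hM := massSum_pos hm
  have hB := mass_le_massSum hm
  set J := 2 * √(massSum m N) + massSum m N with hJ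
  have hJ0 : 0 < J := by positivity
  have hΛ := rateBound_nonneg hm ha hb
  set Λ := rateBound m a b with hΛdef
  -- Converts the drift from the span to G = √(1 + variance): since G ≤ 1 + √M · span, the bound -c
  -- · span + R is at most -c₁ G + (c₁ + R).
  set c₁ := c / √(massSum m N) with hc₁
  have hc₁pos : 0 < c₁ := by positivity
  set R₁ := c₁ + R with hR₁
  have hR₁pos : 0 < R₁ := by positivity
  -- The first-order gain is θ c₁ / 2, and θ is so small that the second-order error is at most θ c₁
  -- / 8. Of the remaining 3 θ c₁ / 8, the part θ c₁ / 4 becomes κ and θ c₁ / 8 absorbs `R₁ / (2 *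
  -- G)` for large G.
  obtain ⟨θ, hθ, hθ1, hθ2⟩ : ∃ θ : ℝ, 0 < θ ∧ θ * J ≤ 1 ∧ Λ * J ^ 2 * θ ≤ c₁ / 8 := by
    refine ⟨min J⁻¹ (c₁ / 8 / (Λ * J ^ 2 + 1)), by positivity, ?_, ?_⟩
    · calc _ ≤ J⁻¹ * J := mul_le_mul_of_nonneg_right (min_le_left _ _) hJ0.le
        _ = 1 := inv_mul_cancel₀ hJ0.ne'
    · calc _ ≤ Λ * J ^ 2 * (c₁ / 8 / (Λ * J ^ 2 + 1)) :=
            mul_le_mul_of_nonneg_left (min_le_right _ _) (by positivity)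
        _ ≤ (Λ * J ^ 2 + 1) * (c₁ / 8 / (Λ * J ^ 2 + 1)) :=
            mul_le_mul_of_nonneg_right (by linarith) (by positivity)
        _ = c₁ / 8 := by field_simp
  refine ⟨θ, θ * c₁ / 4, θ * Real.exp (θ * (4 * R₁ / c₁)) * (R₁ / 2), hθ, by positivity,
    by positivity, fun x hx => ?_⟩
  refine (generator_lyapunov_le_variance hm ha hb hB hθ.le hθ1 x).trans ?_
  have hv := variance_nonneg hm x
  set G := √(1 + variance m x) with hG
  have hG1 : 1 ≤ G := Real.one_le_sqrt.2 (by linarith)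
  have hs : (0 : ℝ) ≤ span x := by exact_mod_cast span_nonneg x
  have hGs : G ≤ 1 + √(massSum m N) * span x := by
    refine Real.sqrt_le_iff.2 ⟨by positivity, ?_⟩
    have h := variance_le_span_sq hm x
    have h2 := Real.sq_sqrt hM.le
    have h3 : 0 ≤ √(massSum m N) * span x := by positivity
    nlinarith
  have hgen : generator m a b (variance m) x ≤ -c₁ * G + R₁ := by
    refine (hvar x hx).trans ?_
    have : c₁ * G ≤ c₁ * (1 + √(massSum m N) * span x) := mul_le_mul_of_nonneg_left hGs hc₁pos.le
    have e : c₁ * (1 + √(massSum m N) * span x) = c₁ + c * span x := by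
      rw [hc₁]; field_simp
    linarith
  have hV : 0 < lyapunov m θ x := Real.exp_pos _
  have hVdef : lyapunov m θ x = Real.exp (θ * G) := rfl
  set V := lyapunov m θ x
  have h1 : θ * (2 * G)⁻¹ * generator m a b (variance m) x ≤ θ * (-(c₁ / 2) + R₁ / (2 * G)) := by
    calc _ ≤ θ * (2 * G)⁻¹ * (-c₁ * G + R₁) := mul_le_mul_of_nonneg_left hgen (by positivity)
      _ = _ := by field_simp
  have h2 : Λ * (θ * J) ^ 2 ≤ θ * (c₁ / 8) := by
    calc Λ * (θ * J) ^ 2 = θ * (Λ * J ^ 2 * θ) := by ring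
      _ ≤ _ := mul_le_mul_of_nonneg_left hθ2 hθ.le
  have h3 : V * (θ * (2 * G)⁻¹ * generator m a b (variance m) x + Λ * (θ * J) ^ 2) ≤
      V * (θ * (-(c₁ / 2) + R₁ / (2 * G)) + θ * (c₁ / 8)) :=
    mul_le_mul_of_nonneg_left (add_le_add h1 h2) hV.le
  refine h3.trans ?_
  have h4 : V * (θ * (-(c₁ / 8) + R₁ / (2 * G))) ≤
      θ * Real.exp (θ * (4 * R₁ / c₁)) * (R₁ / 2) := by
    -- Beyond this threshold the bracket is nonpositive; below it V itself is bounded, which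
    -- produces the constant K.
    rcases le_total (4 * R₁ / c₁) G with hle | hle
    · refine le_trans (mul_nonpos_of_nonneg_of_nonpos hV.le
        (mul_nonpos_of_nonneg_of_nonpos hθ.le ?_)) (by positivity)
      rw [div_le_iff₀ hc₁pos] at hle
      have : R₁ / (2 * G) ≤ c₁ / 8 := by
        rw [div_le_iff₀ (by positivity)]; linarith
      linarith
    · have hVle : V ≤ Real.exp (θ * (4 * R₁ / c₁)) := by
        rw [hVdef]
        exact Real.exp_le_exp.2 (mul_le_mul_of_nonneg_left hle hθ.le)
      have h5 : -(c₁ / 8) + R₁ / (2 * G) ≤ R₁ / 2 := by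
        have : R₁ / (2 * G) ≤ R₁ / 2 := div_le_div_of_nonneg_left hR₁pos.le two_pos (by linarith)
        linarith
      calc V * (θ * (-(c₁ / 8) + R₁ / (2 * G))) ≤ V * (θ * (R₁ / 2)) :=
            mul_le_mul_of_nonneg_left (mul_le_mul_of_nonneg_left h5 hθ.le) hV.le
        _ ≤ Real.exp (θ * (4 * R₁ / c₁)) * (θ * (R₁ / 2)) :=
            mul_le_mul_of_nonneg_right hVle (by positivity)
        _ = _ := by ring
  linarith

/-! ### Displacement of a block: the drift estimate for necessity -/

/-- The coefficients of the relative displacement of the first `k` particles with respect to the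
centre of mass. -/
def blockCoeff (m : Fin N → ℝ) (k : ℕ) (i : Fin N) : ℝ :=
  (if i.val < k then 1 else 0) - massSum m k / massSum m N

lemma sum_blockCoeff_mul (m : Fin N → ℝ) (k : ℕ) (g : Fin N → ℝ) :
    ∑ i, blockCoeff m k i * g i =
      ∑ i : Fin N with i.val < k, g i - massSum m k / massSum m N * ∑ i, g i := by
  unfold blockCoeff
  simp_rw [sub_mul]
  rw [Finset.sum_sub_distrib, Finset.mul_sum, Finset.sum_filter]
  congr 1
  exact Finset.sum_congr rfl fun i _ => by split_ifs <;> simp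

lemma sum_blockCoeff_mass [NeZero N] {m : Fin N → ℝ} (hm : ∀ i, 0 < m i) (k : ℕ) :
    ∑ i, blockCoeff m k i * m i = 0 := by
  have hM := massSum_pos hm
  rw [sum_blockCoeff_mul, ← massSum_all]
  change massSum m k - _ = 0
  field_simp
  ring

lemma massSum_lt [NeZero N] {m : Fin N → ℝ} (hm : ∀ i, 0 < m i) {k : ℕ} (hk : k < N) :
    massSum m k < massSum m N := by
  unfold massSum
  refine Finset.sum_lt_sum_of_subset (i := ⟨k, hk⟩) (fun i _ => by simp) (by simp)
    (by simp) (hm _) fun j _ _ => (hm j).le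

lemma massSum_pos_of_pos [NeZero N] {m : Fin N → ℝ} (hm : ∀ i, 0 < m i) {k : ℕ} (hk : 1 ≤ k) :
    0 < massSum m k :=
  Finset.sum_pos (fun i _ => hm i) ⟨0, by simp; omega⟩

/-- If the stability condition fails at `k`, then the squared relative displacement of the first
`k` particles has drift bounded below by a positive constant. -/
lemma exists_le_generator_block_sq [NeZero N] {m a b : Fin N → ℝ} (hm : ∀ i, 0 < m i)
    (ha : ∀ i, 0 ≤ a i) (hb : ∀ i, 0 ≤ b i) (hpos : 0 < ∑ i, (a i + b i)) {k : ℕ} (hk1 : 1 ≤ k)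
    (hkN : k < N) (hk : potSum m a b N / massSum m N ≤ potSum m a b k / massSum m k) :
    ∃ q : ℝ, 0 < q ∧ ∀ x : Fin N → ℤ, Monotone x →
      q ≤ generator m a b (fun y => wsum (fun i => blockCoeff m k i * m i) y ^ 2) x := by
  have hM := massSum_pos hm
  have hMk := massSum_pos_of_pos hm hk1
  have hlt := massSum_lt hm hkN
  have hp0 : 0 < massSum m k / massSum m N := div_pos hMk hM
  have hp1 : massSum m k / massSum m N < 1 := (div_lt_one hM).2 hlt
  have hanti : Antitone (blockCoeff m k) := by
    intro i j hij
    unfold blockCoeff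
    have : (i : ℕ) ≤ j := hij
    split_ifs <;> first | omega | linarith
  -- The mass fraction of the block lies strictly between 0 and 1, so no coefficient vanishes and
  -- every possible jump moves W; this gives a nondegenerate quadratic variation.
  have hne : ∀ i, 0 < m i * blockCoeff m k i ^ 2 := by
    intro i
    refine mul_pos (hm i) ((sq_nonneg _).lt_of_ne' (pow_ne_zero 2 ?_))
    unfold blockCoeff
    split_ifs <;> intro h <;> linarith
  obtain ⟨c, hc, hc'⟩ := exists_pos_le_of_forall_pos Finset.univ _ fun i _ => hne i
  have hmom : 0 < ∑ j, m j * (a j + b j) := by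
    obtain ⟨j, -, hj⟩ := Finset.exists_lt_of_sum_lt (s := Finset.univ) (f := fun _ : Fin N => (0:ℝ))
      (g := fun i => a i + b i) (by simpa using hpos)
    exact Finset.sum_pos' (fun i _ => mul_nonneg (hm i).le (add_nonneg (ha i) (hb i)))
      ⟨j, Finset.mem_univ j, mul_pos (hm j) hj⟩
  refine ⟨c * ∑ j, m j * (a j + b j), mul_pos hc hmom, fun x hx => ?_⟩
  set w : Fin N → ℝ := fun i => blockCoeff m k i * m i with hw
  have hW : wsum w x ≤ 0 := by
    -- The first particle outside the block serves as origin, which is allowed because the weights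
    -- sum to zero. Weights are positive to its left and negative from it onwards, so every term is
    -- nonpositive.
    set p : Fin N := ⟨k, hkN⟩
    have h0 : ∑ i, w i = 0 := sum_blockCoeff_mass hm k
    have e : wsum w x = ∑ i, w i * ((x i : ℝ) - x p) := by
      simp_rw [mul_sub]
      rw [Finset.sum_sub_distrib, ← Finset.sum_mul, h0]
      simp [wsum]
    rw [e]
    refine Finset.sum_nonpos fun i _ => ?_
    rcases lt_or_ge (i : ℕ) k with hi | hi
    · refine mul_nonpos_of_nonneg_of_nonpos ?_ ?_
      · refine mul_nonneg ?_ (hm i).le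
        rw [blockCoeff, if_pos hi]; linarith
      · have : (x i : ℝ) ≤ x p := by exact_mod_cast hx (show i ≤ p from hi.le)
        linarith
    · refine mul_nonpos_of_nonpos_of_nonneg ?_ ?_
      · refine mul_nonpos_of_nonpos_of_nonneg ?_ (hm i).le
        rw [blockCoeff, if_neg (by omega)]; linarith
      · have : (x p : ℝ) ≤ x i := by exact_mod_cast hx (show p ≤ i from hi)
        linarith
  obtain ⟨l, r, hl, hr, hgen⟩ := generator_eq m a b hx
  rw [hgen]
  -- The coefficients decrease with the index. Replacing j by `r j ≥ j` for right jumps and by `l j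
  -- ≤ j` for left jumps therefore lowers the drift below its value for independent particles, which
  -- is nonpositive by the failure of stability at k.
  have hdrift : ∑ j, (m j * b j * blockCoeff m k (r j) - m j * a j * blockCoeff m k (l j)) ≤ 0 := by
    calc _ ≤ ∑ j, blockCoeff m k j * (m j * (b j - a j)) := by
          refine Finset.sum_le_sum fun j _ => ?_
          have h1 := mul_le_mul_of_nonneg_left (hanti (hr j).1) (mul_nonneg (hm j).le (hb j))
          have h2 := mul_le_mul_of_nonneg_left (hanti (hl j).1) (mul_nonneg (hm j).le (ha j))
          linarith
      _ = -potSum m a b k + massSum m k * (potSum m a b N / massSum m N) := by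
          rw [sum_blockCoeff_mul, potSum_all, potSum]
          ring
      _ ≤ 0 := by
          rw [le_div_iff₀ hMk] at hk
          linarith [mul_comm (massSum m k) (potSum m a b N / massSum m N)]
  -- Expanding the squares gives the cross term 2W · drift exactly; the squared jumps are bounded
  -- below by means of `c`.
  have hterm : ∀ j, 2 * wsum w x *
      (m j * b j * blockCoeff m k (r j) - m j * a j * blockCoeff m k (l j))
      + c * (m j * (a j + b j)) ≤
      m j * a j / m (l j) * (wsum w (x - Pi.single (l j) 1) ^ 2 - wsum w x ^ 2)
      + m j * b j / m (r j) * (wsum w (x + Pi.single (r j) 1) ^ 2 - wsum w x ^ 2) := by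
    intro j
    rw [wsum_sub_single, wsum_add_single]
    have h1 := hm (l j)
    have h2 := hm (r j)
    have e1 : m j * a j / m (l j) * ((wsum w x - w (l j)) ^ 2 - wsum w x ^ 2) =
        m j * a j * (-2 * wsum w x * blockCoeff m k (l j) + m (l j) * blockCoeff m k (l j) ^ 2) := by
      simp only [hw]; field_simp; ring
    have e2 : m j * b j / m (r j) * ((wsum w x + w (r j)) ^ 2 - wsum w x ^ 2) =
        m j * b j * (2 * wsum w x * blockCoeff m k (r j) + m (r j) * blockCoeff m k (r j) ^ 2) := by
      simp only [hw]; field_simp; ring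
    rw [e1, e2]
    have g1 := mul_le_mul_of_nonneg_left (hc' (l j) (Finset.mem_univ _))
      (mul_nonneg (hm j).le (ha j))
    have g2 := mul_le_mul_of_nonneg_left (hc' (r j) (Finset.mem_univ _))
      (mul_nonneg (hm j).le (hb j))
    linarith
  refine le_trans ?_ (Finset.sum_le_sum fun j _ => hterm j)
  rw [Finset.sum_add_distrib, ← Finset.mul_sum, ← Finset.mul_sum]
  have := mul_nonneg_of_nonpos_of_nonpos hW hdrift
  linarith

end

/-! ### Analytic tools: joint measurability, Grönwall, logarithms -/

/-- A process with right-continuous paths is jointly measurable. -/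
lemma measurable_uncurry_of_rightContinuous {Ω E : Type*} [MeasurableSpace Ω] [TopologicalSpace E]
    [TopologicalSpace.PseudoMetrizableSpace E] [MeasurableSpace E] [BorelSpace E]
    {Y : ℝ≥0 → Ω → E} (hY : ∀ s, Measurable (Y s))
    (hr : ∀ ω t, ContinuousWithinAt (fun s => Y s ω) (Set.Ici t) t) :
    Measurable fun p : ℝ≥0 × Ω => Y p.1 p.2 := by
  -- A grid point to the right of s, within 1/(n+1): times take countably many values, and
  -- right-continuity gives the limit.
  set τ : ℕ → ℝ≥0 → ℝ≥0 := fun n s => ((⌊((n : ℝ≥0) + 1) * s⌋₊ : ℝ≥0) + 1) / ((n : ℝ≥0) + 1) with hτ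
  have hle : ∀ n s, s ≤ τ n s := by
    intro n s
    rw [hτ, le_div_iff₀ (by positivity), mul_comm]
    exact (Nat.lt_floor_add_one _).le
  have hge : ∀ n s, τ n s ≤ s + 1 / ((n : ℝ≥0) + 1) := by
    intro n s
    simp only [hτ]
    have hn : ((n : ℝ≥0) + 1) ≠ 0 := by positivity
    rw [div_le_iff₀ (by positivity), add_mul s, one_div, inv_mul_cancel₀ hn, mul_comm s]
    exact add_le_add_left (Nat.floor_le (by positivity)) 1
  have hlim : ∀ s, Tendsto (fun n => τ n s) atTop (𝓝[≥] s) := by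
    intro s
    refine tendsto_nhdsWithin_iff.2 ⟨?_, Eventually.of_forall fun n => hle n s⟩
    refine tendsto_of_tendsto_of_tendsto_of_le_of_le tendsto_const_nhds ?_ (fun n => hle n s)
      (fun n => hge n s)
    have : Tendsto (fun n : ℕ => s + 1 / ((n : ℝ≥0) + 1)) atTop (𝓝 (s + 0)) :=
      tendsto_const_nhds.add tendsto_one_div_add_atTop_nhds_zero_nat
    simpa using this
  refine measurable_of_tendsto_metrizable (f := fun n (p : ℝ≥0 × Ω) => Y (τ n p.1) p.2)
    (fun n => ?_) ?_
  · have h1 : ∀ g : ℕ → Ω → E, (∀ k, Measurable (g k)) → ∀ ν : ℝ≥0 → ℕ, Measurable ν →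
        Measurable fun p : ℝ≥0 × Ω => g (ν p.1) p.2 := fun g hg ν hν =>
      (measurable_from_prod_countable_right (f := fun q : ℕ × Ω => g q.1 q.2) hg).comp
        ((hν.comp measurable_fst).prodMk measurable_snd)
    exact h1 (fun k => Y (((k : ℝ≥0) + 1) / ((n : ℝ≥0) + 1))) (fun k => hY _)
      (fun s => ⌊((n : ℝ≥0) + 1) * s⌋₊) (Measurable.nat_floor (measurable_const.mul measurable_id))
  · rw [tendsto_pi_nhds]
    exact fun p => (hr p.2 p.1).tendsto.comp (hlim p.1)

lemma stronglyMeasurable_intervalIntegral {Ω : Type*} [MeasurableSpace Ω] {Z : ℝ × Ω → ℝ}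
    (hZ : Measurable Z) {u t : ℝ} (hut : u ≤ t) :
    StronglyMeasurable fun ω => ∫ s in u..t, Z (s, ω) := by
  simp_rw [intervalIntegral.integral_of_le hut]
  exact hZ.stronglyMeasurable.integral_prod_left'

/-- Grönwall's inequality for a function given as a primitive. -/
lemma le_gronwallBound_of_eq_integral {φ ψ : ℝ → ℝ} {φ₀ β K T : ℝ} (hT : 0 ≤ T)
    (hψ : IntervalIntegrable ψ volume 0 T)
    (hφ : ∀ t ∈ Set.Icc 0 T, φ t = φ₀ + ∫ s in (0 : ℝ)..t, ψ s)
    (hle : ∀ t ∈ Set.Icc 0 T, ψ t ≤ β * φ t + K) : φ T ≤ gronwallBound φ₀ β K T := by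
  have hcont : ContinuousOn φ (Set.Icc 0 T) := by
    have h := intervalIntegral.continuousOn_primitive_interval' hψ Set.left_mem_uIcc
    rw [Set.uIcc_of_le hT] at h
    exact (continuousOn_const.add h).congr hφ
  set g : ℝ → ℝ := fun t => β * φ t + K with hg
  have hgc : ContinuousOn g (Set.Icc 0 T) := (continuousOn_const.mul hcont).add continuousOn_const
  have hbound := le_gronwallBound_of_liminf_deriv_right_le (f := φ) (f' := g) (δ := φ₀) (K := β)
    (ε := K) (a := 0) (b := T) hcont ?_ ?_ (fun x _ => le_rfl) T ⟨hT, le_rfl⟩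
  · simpa using hbound
  · intro x hx r hr
    -- The integrand ψ need not be continuous, so the difference quotient of φ is estimated by
    -- averaging ψ ≤ g over [x, z], with the continuous g kept below the midpoint of `g x` and `r`.
    have hev : ∀ᶠ z in 𝓝[>] x, z ∈ Set.Ioc x T ∧ ∀ s ∈ Set.Icc x z, g s < (g x + r) / 2 := by
      have h1 : ∀ᶠ s in 𝓝[Set.Icc 0 T] x, g s < (g x + r) / 2 :=
        (hgc x ⟨hx.1, hx.2.le⟩).eventually_lt_const (by linarith)
      rw [eventually_nhdsWithin_iff, Metric.eventually_nhds_iff] at h1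
      obtain ⟨ε, hε, h1⟩ := h1
      have h2 : Set.Ioo x (min T (x + ε)) ∈ 𝓝[>] x :=
        Ioo_mem_nhdsGT (lt_min hx.2 (by linarith))
      filter_upwards [h2] with z hz
      have hzT : z < T := hz.2.trans_le (min_le_left _ _)
      have hzε : z < x + ε := hz.2.trans_le (min_le_right _ _)
      refine ⟨⟨hz.1, hzT.le⟩, fun s hs => h1 ?_ ⟨hx.1.trans hs.1, hs.2.trans hzT.le⟩⟩
      rw [Real.dist_eq, abs_of_nonneg (by linarith [hs.1])]
      linarith [hs.2]
    refine hev.frequently.mono fun z hz => ?_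
    obtain ⟨hz1, hz2⟩ := hz
    have hsub : φ z - φ x = ∫ s in x..z, ψ s := by
      rw [hφ z ⟨hx.1.trans hz1.1.le, hz1.2⟩, hφ x ⟨hx.1, hx.2.le⟩, add_sub_add_left_eq_sub]
      refine intervalIntegral.integral_interval_sub_left ?_ ?_
      · exact hψ.mono_set (by
          rw [Set.uIcc_of_le hT, Set.uIcc_of_le (hx.1.trans hz1.1.le)]
          exact Set.Icc_subset_Icc le_rfl hz1.2)
      · exact hψ.mono_set (by
          rw [Set.uIcc_of_le hT, Set.uIcc_of_le hx.1]
          exact Set.Icc_subset_Icc le_rfl hx.2.le)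
    have hint : ∫ s in x..z, ψ s ≤ ∫ _ in x..z, (g x + r) / 2 := by
      refine intervalIntegral.integral_mono_on hz1.1.le ?_ (by simp) fun s hs => ?_
      · exact hψ.mono_set (by
          rw [Set.uIcc_of_le hT, Set.uIcc_of_le hz1.1.le]
          exact Set.Icc_subset_Icc hx.1 hz1.2)
      · exact (hle s ⟨hx.1.trans hs.1, hs.2.trans hz1.2⟩).trans (hz2 s hs).le
    rw [intervalIntegral.integral_const, smul_eq_mul] at hint
    have hzx : 0 < z - x := sub_pos.2 hz1.1
    rw [hsub, inv_mul_lt_iff₀ hzx]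
    nlinarith
  · rw [hφ 0 ⟨le_rfl, hT⟩]; simp

/-- For t ≥ 2 one has t + 1 ≤ t², so the right side is at most t⁴ = exp(4 log t). -/
lemma le_log_of_exp_le_sq {δ s t : ℝ} (hδ : 0 < δ) (ht : 2 ≤ t)
    (h : Real.exp (δ * s) ≤ (t + 1) ^ 2) : s ≤ 4 / δ * Real.log t := by
  have h1 : δ * s ≤ 4 * Real.log t := by
    rw [← Real.exp_le_exp]
    refine h.trans ?_
    have h2 : Real.exp (4 * Real.log t) = t ^ 4 := by
      rw [mul_comm, Real.exp_mul, Real.exp_log (by linarith)]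
      norm_cast
    rw [h2]
    have h3 : t + 1 ≤ t ^ 2 := by nlinarith
    calc (t + 1) ^ 2 ≤ (t ^ 2) ^ 2 := by gcongr
      _ = t ^ 4 := by ring
  rw [div_mul_eq_mul_div, le_div_iff₀ hδ]
  linarith

/-- If the span is sublinear, then all particles follow the centre of mass. -/
lemma tendsto_position_of_span {N : ℕ} [NeZero N] {m : Fin N → ℝ} (hm : ∀ i, 0 < m i)
    {δ U : ℝ} (hδ : 0 < δ)
    {x : ℝ≥0 → Fin N → ℤ}
    (hspan : ∀ᶠ t : ℝ≥0 in atTop, Real.exp (δ * span (x t)) ≤ ((t : ℝ) + 1) ^ 2)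
    (hmom : Tendsto (fun t : ℝ≥0 => wsum m (x t) / t) atTop (𝓝 (-U))) (i : Fin N) :
    Tendsto (fun t : ℝ≥0 => (x t i : ℝ) / t) atTop (𝓝 (-(U / massSum m N))) := by
  have hM := massSum_pos hm
  have h1 : Tendsto (fun t : ℝ≥0 => wsum m (x t) / t / massSum m N) atTop
      (𝓝 (-(U / massSum m N))) := by
    rw [← neg_div]; exact hmom.div_const _
  have hlog : Tendsto (fun t : ℝ≥0 => 4 / δ * (Real.log t / t)) atTop (𝓝 0) := by
    have h := (Real.isLittleO_log_id_atTop.tendsto_div_nhds_zero).comp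
      (NNReal.tendsto_coe_atTop.2 tendsto_id)
    have h' := h.const_mul (4 / δ)
    rw [mul_zero] at h'
    exact h'
  have h2 : Tendsto (fun t : ℝ≥0 => ((x t i : ℝ) - wsum m (x t) / massSum m N) / t) atTop
      (𝓝 0) := by
    refine squeeze_zero_norm' ?_ hlog
    filter_upwards [hspan, eventually_ge_atTop 2] with t ht ht2
    have ht2' : (2 : ℝ) ≤ t := by exact_mod_cast ht2
    have hs := le_log_of_exp_le_sq hδ ht2' ht
    rw [Real.norm_eq_abs, abs_div, abs_of_pos (by linarith : (0 : ℝ) < t), ← mul_div_assoc]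
    exact div_le_div_of_nonneg_right ((abs_sub_center_le hm _ i).trans hs) (by linarith)
  have h3 := h2.add h1
  rw [zero_add] at h3
  refine h3.congr fun t => ?_
  rw [div_right_comm, ← add_div]
  ring

/-! ### Measurability along the paths -/

section

variable {N : ℕ} {m a b : Fin N → ℝ} {x₀ : Fin N → ℤ} {Ω : Type*} [MeasurableSpace Ω]
  {μ : Measure Ω} {X : ℝ≥0 → Ω → Fin N → ℤ}

namespace IsElasticSystem

lemma continuousWithinAt (hX : IsElasticSystem m a b x₀ μ X) (ω : Ω) (t : ℝ≥0) :
    ContinuousWithinAt (fun s => X s ω) (Set.Ici t) t :=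
  tendsto_nhds_of_eventually_eq (hX.rightCont ω t)

lemma measurable_uncurry (hX : IsElasticSystem m a b x₀ μ X) (f : (Fin N → ℤ) → ℝ) :
    Measurable fun p : ℝ × Ω => f (X p.1.toNNReal p.2) := by
  have h := measurable_uncurry_of_rightContinuous (fun s => (hX.stronglyMeasurable s).measurable)
    hX.continuousWithinAt
  have h2 : Measurable fun p : ℝ × Ω => (p.1.toNNReal, p.2) :=
    measurable_fst.real_toNNReal.prodMk measurable_snd
  exact (Measurable.of_discrete (f := f)).comp (h.comp h2)

lemma measurable_comp (hX : IsElasticSystem m a b x₀ μ X) (f : (Fin N → ℤ) → ℝ) (t : ℝ≥0) :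
    Measurable fun ω => f (X t ω) :=
  (Measurable.of_discrete (f := f)).comp (hX.stronglyMeasurable t).measurable

lemma measurable_path (hX : IsElasticSystem m a b x₀ μ X) (f : (Fin N → ℤ) → ℝ) (ω : Ω) :
    Measurable fun s : ℝ => f (X s.toNNReal ω) :=
  (hX.measurable_uncurry f).comp (measurable_id.prodMk measurable_const)

/-- Additive functionals over `[u, t]` are measurable with respect to the past of `t`. -/
lemma stronglyMeasurable_integral_natural (hX : IsElasticSystem m a b x₀ μ X)
    (f : (Fin N → ℤ) → ℝ) {u : ℝ} {t : ℝ≥0} (hut : u ≤ t) :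
    StronglyMeasurable[Filtration.natural X hX.stronglyMeasurable t]
      fun ω => ∫ s in u..t, f (X s.toNNReal ω) := by
  -- Freezing the path at time t makes all its marginals measurable for the past of t and does not
  -- change the integral up to t. Joint measurability is then used with the smaller σ-algebra.
  have hY : ∀ s, Measurable[Filtration.natural X hX.stronglyMeasurable t] (X (min s t)) := fun s =>
    ((Filtration.stronglyAdapted_natural hX.stronglyMeasurable (min s t)).mono
      ((Filtration.natural X hX.stronglyMeasurable).mono (min_le_right s t))).measurable
  have hr : ∀ ω s, ContinuousWithinAt (fun s => X (min s t) ω) (Set.Ici s) s := by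
    intro ω s
    refine ContinuousWithinAt.comp (t := Set.Ici (min s t)) (f := fun s => min s t)
      (g := fun s => X s ω) (hX.continuousWithinAt ω _) ?_ ?_
    · exact (continuous_id.min continuous_const).continuousWithinAt
    · exact fun s' hs' => min_le_min_right t hs'
  have h := @measurable_uncurry_of_rightContinuous Ω _ (Filtration.natural X hX.stronglyMeasurable t)
    _ _ _ _ (fun s => X (min s t)) hY hr
  have hZ : @Measurable (ℝ × Ω) ℝ
      (@Prod.instMeasurableSpace _ _ _ (Filtration.natural X hX.stronglyMeasurable t)) _
      (fun p => f (X (min p.1.toNNReal t) p.2)) := by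
    let _ := Filtration.natural X hX.stronglyMeasurable t
    have h2 : Measurable fun p : ℝ × Ω => (p.1.toNNReal, p.2) :=
      measurable_fst.real_toNNReal.prodMk measurable_snd
    exact (Measurable.of_discrete (f := f)).comp (h.comp h2)
  have hI := @stronglyMeasurable_intervalIntegral Ω (Filtration.natural X hX.stronglyMeasurable t)
    _ hZ u t hut
  convert hI using 2 with ω
  refine intervalIntegral.integral_congr fun s hs => ?_
  rw [Set.uIcc_of_le hut] at hs
  simp only
  rw [min_eq_left (Real.toNNReal_le_iff_le_coe.2 hs.2)]

end IsElasticSystem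

lemma abs_generator_le_of_bounded (hm : ∀ i, 0 < m i) (ha : ∀ i, 0 ≤ a i)
    (hb : ∀ i, 0 ≤ b i) {f : (Fin N → ℤ) → ℝ} {K : ℝ} (hf : ∀ x, |f x| ≤ K) (x : Fin N → ℤ) :
    |generator m a b f x| ≤ rateBound m a b * (2 * K) := by
  have hK : 0 ≤ K := (abs_nonneg _).trans (hf x)
  have h : ∀ y, |f y - f x| ≤ 2 * K := fun y => by
    refine (abs_sub _ _).trans ?_
    linarith [hf y, hf x]
  exact abs_generator_le hm ha hb (by positivity) (fun i => h _) fun i => h _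

/-! ### Exponential growth and Dynkin's formula -/

/-- The weight `exp (c ∑ |x i|)`. -/
def expNorm (c : ℝ) (x : Fin N → ℤ) : ℝ := Real.exp (c * ∑ i, |(x i : ℝ)|)

lemma expNorm_pos (c : ℝ) (x : Fin N → ℤ) : 0 < expNorm c x := Real.exp_pos _

lemma sum_abs_le_of_single (x y : Fin N → ℤ) (i : Fin N) (h : ∀ j ≠ i, y j = x j)
    (hi : |(y i : ℝ)| ≤ |(x i : ℝ)| + 1) : ∑ j, |(y j : ℝ)| ≤ ∑ j, |(x j : ℝ)| + 1 := by
  have : ∀ j, |(y j : ℝ)| ≤ |(x j : ℝ)| + if j = i then 1 else 0 := by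
    intro j
    by_cases hj : j = i
    · subst hj; simpa using hi
    · simp [hj, h j hj]
  refine (Finset.sum_le_sum fun j _ => this j).trans ?_
  rw [Finset.sum_add_distrib]
  simp

lemma expNorm_add_single_le {c : ℝ} (hc : 0 ≤ c) (x : Fin N → ℤ) (i : Fin N) :
    expNorm c (x + Pi.single i 1) ≤ Real.exp c * expNorm c x := by
  unfold expNorm
  rw [← Real.exp_add]
  refine Real.exp_le_exp.2 ?_
  have := sum_abs_le_of_single x (x + Pi.single i 1) i (fun j hj => by simp [hj])
    (by simpa using abs_add_le (x i : ℝ) 1)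
  nlinarith

lemma expNorm_sub_single_le {c : ℝ} (hc : 0 ≤ c) (x : Fin N → ℤ) (i : Fin N) :
    expNorm c (x - Pi.single i 1) ≤ Real.exp c * expNorm c x := by
  unfold expNorm
  rw [← Real.exp_add]
  refine Real.exp_le_exp.2 ?_
  have := sum_abs_le_of_single x (x - Pi.single i 1) i (fun j hj => by simp [hj])
    (by simpa using abs_sub (x i : ℝ) 1)
  nlinarith

/-- Functions of at most exponential growth. -/
def HasExpGrowth (f : (Fin N → ℤ) → ℝ) : Prop :=
  ∃ c C : ℝ, 0 ≤ c ∧ 0 ≤ C ∧ ∀ x, |f x| ≤ C * expNorm c x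

/-- A jump changes ∑ |x_i| by at most one, hence the weight by at most a factor `exp c`. With
bounded rates the generator thus preserves the growth exponent `c`. -/
lemma abs_generator_le_expNorm (hm : ∀ i, 0 < m i) (ha : ∀ i, 0 ≤ a i)
    (hb : ∀ i, 0 ≤ b i) {f : (Fin N → ℤ) → ℝ} {c C : ℝ} (hc : 0 ≤ c) (hC : 0 ≤ C)
    (hf : ∀ x, |f x| ≤ C * expNorm c x) (x : Fin N → ℤ) :
    |generator m a b f x| ≤ rateBound m a b * (C * (Real.exp c + 1)) * expNorm c x := by
  have hx := expNorm_pos c x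
  have key : ∀ y, expNorm c y ≤ Real.exp c * expNorm c x →
      |f y - f x| ≤ C * (Real.exp c + 1) * expNorm c x := fun y hy => by
    refine (abs_sub _ _).trans ?_
    have := mul_le_mul_of_nonneg_left hy hC
    linarith [hf y, hf x]
  rw [mul_assoc]
  exact abs_generator_le hm ha hb (by positivity) (fun i => key _ (expNorm_sub_single_le hc x i))
    fun i => key _ (expNorm_add_single_le hc x i)

namespace IsElasticSystem

lemma integrable_of_bounded [IsProbabilityMeasure μ]
    (hX : IsElasticSystem m a b x₀ μ X) {f : (Fin N → ℤ) → ℝ} {K : ℝ}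
    (hf : ∀ x, |f x| ≤ K) (t : ℝ≥0) : Integrable (fun ω => f (X t ω)) μ :=
  Integrable.of_bound (hX.measurable_comp f t).aestronglyMeasurable K
    (ae_of_all _ fun ω => by simpa using hf (X t ω))

lemma intervalIntegrable_path (hX : IsElasticSystem m a b x₀ μ X) {f : (Fin N → ℤ) → ℝ} {K : ℝ}
    (hf : ∀ x, |f x| ≤ K) (ω : Ω) (u t : ℝ) :
    IntervalIntegrable (fun s : ℝ => f (X s.toNNReal ω)) volume u t := by
  refine (intervalIntegrable_const (c := K)).mono_fun
    (hX.measurable_path f ω).aestronglyMeasurable (ae_of_all _ fun s => ?_)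
  simpa using (hf (X s.toNNReal ω)).trans (le_abs_self K)

lemma integral_intervalIntegral_comm [IsProbabilityMeasure μ]
    (hX : IsElasticSystem m a b x₀ μ X) {f : (Fin N → ℤ) → ℝ} {K : ℝ}
    (hf : ∀ x, |f x| ≤ K) (u t : ℝ) :
    ∫ s in u..t, ∫ ω, f (X s.toNNReal ω) ∂μ = ∫ ω, (∫ s in u..t, f (X s.toNNReal ω)) ∂μ := by
  refine intervalIntegral_integral_swap ?_
  have : IsFiniteMeasure (volume.restrict (Set.uIoc u t)) := by
    refine ⟨?_⟩
    rw [Measure.restrict_apply_univ, Set.uIoc]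
    exact measure_Ioc_lt_top
  refine Integrable.of_bound (C := K) ?_ (ae_of_all _ fun p => ?_)
  · exact (hX.measurable_uncurry f).aestronglyMeasurable
  · simpa [Function.uncurry] using hf (X p.1.toNNReal p.2)

/-- Dynkin's formula for bounded functions. -/
lemma dynkin_of_bounded [IsProbabilityMeasure μ] (hm : ∀ i, 0 < m i) (ha : ∀ i, 0 ≤ a i)
    (hb : ∀ i, 0 ≤ b i) (hX : IsElasticSystem m a b x₀ μ X) {f : (Fin N → ℤ) → ℝ} {K : ℝ}
    (hf : ∀ x, |f x| ≤ K) (t : ℝ≥0) :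
    ∫ ω, f (X t ω) ∂μ =
      f x₀ + ∫ s in (0 : ℝ)..t, ∫ ω, generator m a b f (X s.toNNReal ω) ∂μ := by
  have hLf := abs_generator_le_of_bounded hm ha hb hf
  obtain ⟨-, -, -, hstart, -⟩ := id hX
  have h := (hX.martingale f ⟨K, hf⟩).setIntegral_eq (zero_le : 0 ≤ t) MeasurableSet.univ
  simp only [Measure.restrict_univ, NNReal.coe_zero, intervalIntegral.integral_same, sub_zero,
    hstart] at h
  have hint : Integrable (fun ω => ∫ s in (0 : ℝ)..t, generator m a b f (X s.toNNReal ω)) μ := by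
    have h1 := (hX.martingale f ⟨K, hf⟩).integrable t
    have h2 := (hX.integrable_of_bounded hf t).sub h1
    refine h2.congr (ae_of_all _ fun ω => ?_)
    simp
  rw [integral_sub (hX.integrable_of_bounded hf t) hint,
    ← hX.integral_intervalIntegral_comm hLf] at h
  simp only [integral_const, probReal_univ, one_smul] at h
  linarith

lemma stronglyMeasurable_integral_comp [IsProbabilityMeasure μ]
    (hX : IsElasticSystem m a b x₀ μ X) (f : (Fin N → ℤ) → ℝ) :
    StronglyMeasurable fun s : ℝ => ∫ ω, f (X s.toNNReal ω) ∂μ :=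
  (hX.measurable_uncurry f).stronglyMeasurable.integral_prod_right'

lemma intervalIntegrable_integral_comp [IsProbabilityMeasure μ]
    (hX : IsElasticSystem m a b x₀ μ X) {f : (Fin N → ℤ) → ℝ} {K : ℝ}
    (hf : ∀ x, |f x| ≤ K) (u t : ℝ) :
    IntervalIntegrable (fun s : ℝ => ∫ ω, f (X s.toNNReal ω) ∂μ) volume u t := by
  refine (intervalIntegrable_const (c := K)).mono_fun
    (hX.stronglyMeasurable_integral_comp f).aestronglyMeasurable (ae_of_all _ fun s => ?_)
  refine (norm_integral_le_of_norm_le_const (C := K) (ae_of_all _ fun ω => ?_)).trans ?_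
  · simpa using hf (X s.toNNReal ω)
  · simpa using le_abs_self K

/-- Exponential moments stay finite. -/
lemma expNorm_moment [IsProbabilityMeasure μ] (hm : ∀ i, 0 < m i) (ha : ∀ i, 0 ≤ a i)
    (hb : ∀ i, 0 ≤ b i) (hX : IsElasticSystem m a b x₀ μ X) {c : ℝ} (hc : 0 ≤ c) (t : ℝ≥0) :
    Integrable (fun ω => expNorm c (X t ω)) μ ∧ ∫ ω, expNorm c (X t ω) ∂μ ≤
      expNorm c x₀ * Real.exp (rateBound m a b * (Real.exp c + 1) * t) := by
  set Λ := rateBound m a b * (Real.exp c + 1) with hΛ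
  have hΛ0 : 0 ≤ Λ := mul_nonneg (rateBound_nonneg hm ha hb) (by positivity)
  have hgen : ∀ x : Fin N → ℤ, generator m a b (expNorm c) x ≤ Λ * expNorm c x := fun x => by
    have := abs_generator_le_expNorm hm ha hb hc (zero_le_one)
      (f := expNorm c) (fun x => by rw [abs_of_pos (expNorm_pos c x), one_mul]) x
    rw [one_mul] at this
    exact (le_abs_self _).trans this
  set A := expNorm c x₀ * Real.exp (Λ * t) with hA
  have hA0 : 0 ≤ A := mul_nonneg (expNorm_pos c x₀).le (Real.exp_pos _).le
  -- Truncated weights are admissible in the martingale problem and inherit the drift bound by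
  -- `generator_min_le`; the resulting bound does not depend on n, so monotone convergence removes
  -- the truncation.
  have htrunc : ∀ n : ℕ, ∫ ω, min (expNorm c (X t ω)) n ∂μ ≤ A := by
    intro n
    set f : (Fin N → ℤ) → ℝ := fun x => min (expNorm c x) n with hf
    have hf0 : ∀ x, 0 ≤ f x := fun x => le_min (expNorm_pos c x).le (Nat.cast_nonneg n)
    have hfb : ∀ x, |f x| ≤ n := fun x => by
      rw [abs_of_nonneg (hf0 x)]; exact min_le_right _ _
    have hLf : ∀ x, generator m a b f x ≤ Λ * f x := fun x => by
      refine (generator_min_le hm ha hb (expNorm c) n x).trans ?_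
      split_ifs with h
      · simp only [hf, min_eq_left h]; exact hgen x
      · exact mul_nonneg hΛ0 (hf0 x)
    have hLb := abs_generator_le_of_bounded hm ha hb hfb
    have h := le_gronwallBound_of_eq_integral (φ := fun s => ∫ ω, f (X s.toNNReal ω) ∂μ)
      (ψ := fun s => ∫ ω, generator m a b f (X s.toNNReal ω) ∂μ) (φ₀ := f x₀) (β := Λ) (K := 0)
      (T := t) t.2 (hX.intervalIntegrable_integral_comp hLb 0 t)
      (fun s hs => by
        have := hX.dynkin_of_bounded hm ha hb hfb s.toNNReal
        rwa [Real.coe_toNNReal _ hs.1] at this)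
      (fun s _ => by
        rw [add_zero, ← integral_const_mul]
        exact integral_mono (hX.integrable_of_bounded hLb _)
          ((hX.integrable_of_bounded hfb _).const_mul Λ) fun ω => hLf _)
    rw [gronwallBound_ε0, Real.toNNReal_coe] at h
    exact h.trans (mul_le_mul_of_nonneg_right (min_le_left _ _) (Real.exp_pos _).le)
  have hlin : ∫⁻ ω, ENNReal.ofReal (expNorm c (X t ω)) ∂μ ≤ ENNReal.ofReal A := by
    have hlim := lintegral_tendsto_of_tendsto_of_monotone (μ := μ)
      (f := fun (n : ℕ) ω => ENNReal.ofReal (min (expNorm c (X t ω)) n))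
      (F := fun ω => ENNReal.ofReal (expNorm c (X t ω)))
      (fun n => ((hX.measurable_comp (fun x => min (expNorm c x) n) t).ennreal_ofReal).aemeasurable)
      (ae_of_all _ fun ω n k hnk => ENNReal.ofReal_le_ofReal
        (min_le_min_left _ (by exact_mod_cast hnk)))
      (ae_of_all _ fun ω => by
        refine tendsto_nhds_of_eventually_eq ?_
        filter_upwards [eventually_ge_atTop ⌈expNorm c (X t ω)⌉₊] with n hn
        rw [min_eq_left (Nat.ceil_le.1 hn)])
    refine le_of_tendsto' hlim fun n => ?_
    rw [← ofReal_integral_eq_lintegral_ofReal]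
    · exact ENNReal.ofReal_le_ofReal (htrunc n)
    · exact hX.integrable_of_bounded (f := fun x => min (expNorm c x) n) (K := n)
        (fun x => by
          rw [abs_of_nonneg (le_min (expNorm_pos c x).le (Nat.cast_nonneg n))]
          exact min_le_right _ _) t
    · exact ae_of_all _ fun ω => le_min (expNorm_pos c _).le (Nat.cast_nonneg n)
  have hint : Integrable (fun ω => expNorm c (X t ω)) μ := by
    refine ⟨(hX.measurable_comp _ t).aestronglyMeasurable, ?_⟩
    rw [hasFiniteIntegral_iff_ofReal (ae_of_all _ fun ω => (expNorm_pos c _).le)]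
    exact hlin.trans_lt ENNReal.ofReal_lt_top
  refine ⟨hint, ?_⟩
  rw [integral_eq_lintegral_of_nonneg_ae (ae_of_all _ fun ω => (expNorm_pos c _).le)
    (hX.measurable_comp _ t).aestronglyMeasurable]
  exact ENNReal.toReal_le_of_le_ofReal hA0 hlin

lemma integrable_of_hasExpGrowth [IsProbabilityMeasure μ] (hm : ∀ i, 0 < m i) (ha : ∀ i, 0 ≤ a i)
    (hb : ∀ i, 0 ≤ b i) (hX : IsElasticSystem m a b x₀ μ X) {f : (Fin N → ℤ) → ℝ}
    (hf : HasExpGrowth f) (t : ℝ≥0) : Integrable (fun ω => f (X t ω)) μ := by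
  obtain ⟨c, C, hc, hC, hf⟩ := hf
  exact ((hX.expNorm_moment hm ha hb hc t).1.const_mul C).mono'
    (hX.measurable_comp f t).aestronglyMeasurable (ae_of_all _ fun ω => hf _)

end IsElasticSystem

lemma hasExpGrowth_generator (hm : ∀ i, 0 < m i) (ha : ∀ i, 0 ≤ a i)
    (hb : ∀ i, 0 ≤ b i) {f : (Fin N → ℤ) → ℝ} (hf : HasExpGrowth f) :
    HasExpGrowth (generator m a b f) := by
  obtain ⟨c, C, hc, hC, hf⟩ := hf
  exact ⟨c, _, hc, mul_nonneg (rateBound_nonneg hm ha hb) (by positivity),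
    abs_generator_le_expNorm hm ha hb hc hC hf⟩

namespace IsElasticSystem

lemma abs_integral_le_expNorm [IsProbabilityMeasure μ] (hm : ∀ i, 0 < m i) (ha : ∀ i, 0 ≤ a i)
    (hb : ∀ i, 0 ≤ b i) (hX : IsElasticSystem m a b x₀ μ X) {f : (Fin N → ℤ) → ℝ}
    {c C : ℝ} (hc : 0 ≤ c) (hC : 0 ≤ C) (hf : ∀ x, |f x| ≤ C * expNorm c x) (t : ℝ≥0) :
    |∫ ω, f (X t ω) ∂μ| ≤
      C * (expNorm c x₀ * Real.exp (rateBound m a b * (Real.exp c + 1) * t)) := by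
  obtain ⟨h1, h2⟩ := hX.expNorm_moment hm ha hb hc t
  calc |∫ ω, f (X t ω) ∂μ| ≤ ∫ ω, C * expNorm c (X t ω) ∂μ :=
        norm_integral_le_of_norm_le (f := fun ω => f (X t ω)) (h1.const_mul C)
          (ae_of_all _ fun ω => hf _)
    _ ≤ _ := by
        rw [integral_const_mul]
        exact mul_le_mul_of_nonneg_left h2 hC

lemma intervalIntegrable_of_hasExpGrowth [IsProbabilityMeasure μ] (hm : ∀ i, 0 < m i)
    (ha : ∀ i, 0 ≤ a i) (hb : ∀ i, 0 ≤ b i) (hX : IsElasticSystem m a b x₀ μ X)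
    {f : (Fin N → ℤ) → ℝ} (hf : HasExpGrowth f) {t : ℝ} (ht : 0 ≤ t) :
    IntervalIntegrable (fun s : ℝ => ∫ ω, f (X s.toNNReal ω) ∂μ) volume 0 t := by
  obtain ⟨c, C, hc, hC, hf⟩ := hf
  refine IntervalIntegrable.mono_fun (g := fun s : ℝ => ∫ ω, f (X s.toNNReal ω) ∂μ)
    (f := fun s : ℝ => C * (expNorm c x₀ * Real.exp (rateBound m a b * (Real.exp c + 1) * s)))
    (Continuous.intervalIntegrable (by fun_prop) _ _)
    (hX.stronglyMeasurable_integral_comp f).aestronglyMeasurable ?_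
  rw [Set.uIoc_of_le ht]
  refine (ae_restrict_iff' measurableSet_Ioc).2 (ae_of_all _ fun s hs => ?_)
  have h := hX.abs_integral_le_expNorm hm ha hb hc hC hf s.toNNReal
  rw [Real.coe_toNNReal _ hs.1.le] at h
  exact h.trans (le_abs_self _)

/-- Dynkin's formula for functions of exponential growth. -/
lemma dynkin [IsProbabilityMeasure μ] (hm : ∀ i, 0 < m i) (ha : ∀ i, 0 ≤ a i)
    (hb : ∀ i, 0 ≤ b i) (hX : IsElasticSystem m a b x₀ μ X) {f : (Fin N → ℤ) → ℝ}
    (hf : HasExpGrowth f) (t : ℝ≥0) :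
    ∫ ω, f (X t ω) ∂μ =
      f x₀ + ∫ s in (0 : ℝ)..t, ∫ ω, generator m a b f (X s.toNNReal ω) ∂μ := by
  obtain ⟨c, C, hc, hC, hf⟩ := hf
  -- At each configuration the truncations eventually equal f, and the generator is a finite sum, so
  -- it converges too. The exponential moments supply the dominating functions, in ω and in time.
  set F : ℕ → (Fin N → ℤ) → ℝ := fun n x => max (-(n : ℝ)) (min (f x) n) with hF
  have hFb : ∀ n x, |F n x| ≤ n := fun n x => by
    rw [abs_le]
    exact ⟨le_max_left _ _, max_le (by have := Nat.cast_nonneg (α := ℝ) n; linarith) (min_le_right _ _)⟩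
  have hFf : ∀ n x, |F n x| ≤ |f x| := fun n x => by
    have hn := Nat.cast_nonneg (α := ℝ) n
    rw [abs_le]
    constructor
    · rcases le_total (f x) n with h | h
      · simp only [hF, min_eq_left h]
        exact (neg_abs_le _).trans (le_max_right _ _)
      · refine le_trans ?_ (le_max_right _ _)
        rw [min_eq_right h]
        linarith [abs_nonneg (f x)]
    · refine max_le ?_ ((min_le_left _ _).trans (le_abs_self _))
      linarith [abs_nonneg (f x)]
  have hFC : ∀ n x, |F n x| ≤ C * expNorm c x := fun n x => (hFf n x).trans (hf x)
  have hFlim : ∀ x, Tendsto (fun n => F n x) atTop (𝓝 (f x)) := fun x => by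
    refine tendsto_nhds_of_eventually_eq ?_
    filter_upwards [eventually_ge_atTop ⌈|f x|⌉₊] with n hn
    have hn' := Nat.ceil_le.1 hn
    simp only [hF]
    rw [min_eq_left ((le_abs_self _).trans hn'), max_eq_right]
    linarith [neg_abs_le (f x)]
  have hLlim : ∀ x, Tendsto (fun n => generator m a b (F n) x) atTop
      (𝓝 (generator m a b f x)) := fun x => by
    unfold generator
    exact tendsto_finsetSum _ fun i _ =>
      ((((hFlim _).sub (hFlim _)).const_mul _).add (((hFlim _).sub (hFlim _)).const_mul _))
  set C' := rateBound m a b * (C * (Real.exp c + 1)) with hC'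
  have hC'0 : 0 ≤ C' := mul_nonneg (rateBound_nonneg hm ha hb) (by positivity)
  have hLC : ∀ n x, |generator m a b (F n) x| ≤ C' * expNorm c x := fun n x =>
    abs_generator_le_expNorm hm ha hb hc hC (hFC n) x
  have lim1 : Tendsto (fun n => ∫ ω, F n (X t ω) ∂μ) atTop (𝓝 (∫ ω, f (X t ω) ∂μ)) :=
    tendsto_integral_of_dominated_convergence (fun ω => C * expNorm c (X t ω))
      (fun n => (hX.measurable_comp (F n) t).aestronglyMeasurable)
      ((hX.expNorm_moment hm ha hb hc t).1.const_mul C)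
      (fun n => ae_of_all _ fun ω => hFC n _) (ae_of_all _ fun ω => hFlim _)
  have lim2 : Tendsto (fun n => ∫ s in (0 : ℝ)..t, ∫ ω, generator m a b (F n) (X s.toNNReal ω) ∂μ)
      atTop (𝓝 (∫ s in (0 : ℝ)..t, ∫ ω, generator m a b f (X s.toNNReal ω) ∂μ)) := by
    refine intervalIntegral.tendsto_integral_filter_of_dominated_convergence
      (fun s => C' * (expNorm c x₀ * Real.exp (rateBound m a b * (Real.exp c + 1) * s)))
      (Eventually.of_forall fun n => (hX.stronglyMeasurable_integral_comp _).aestronglyMeasurable)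
      (Eventually.of_forall fun n => ae_of_all _ fun s hs => ?_)
      (Continuous.intervalIntegrable (by fun_prop) _ _) (ae_of_all _ fun s _ => ?_)
    · rw [Set.uIoc_of_le t.coe_nonneg] at hs
      have h := hX.abs_integral_le_expNorm hm ha hb hc hC'0 (hLC n) s.toNNReal
      rwa [Real.coe_toNNReal _ hs.1.le] at h
    · exact tendsto_integral_of_dominated_convergence (fun ω => C' * expNorm c (X s.toNNReal ω))
        (fun n => (hX.measurable_comp _ _).aestronglyMeasurable)
        ((hX.expNorm_moment hm ha hb hc _).1.const_mul C')
        (fun n => ae_of_all _ fun ω => hLC n _) (ae_of_all _ fun ω => hLlim _)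
  refine tendsto_nhds_unique lim1 (((hFlim x₀).add lim2).congr fun n => ?_)
  exact (hX.dynkin_of_bounded hm ha hb (hFb n) t).symm

/-- A drift condition controls the growth of expectations. -/
lemma integral_le_gronwallBound [IsProbabilityMeasure μ] (hm : ∀ i, 0 < m i) (ha : ∀ i, 0 ≤ a i)
    (hb : ∀ i, 0 ≤ b i) (hX : IsElasticSystem m a b x₀ μ X) {f : (Fin N → ℤ) → ℝ}
    (hf : HasExpGrowth f) {β K : ℝ}
    (hL : ∀ x, Monotone x → generator m a b f x ≤ β * f x + K) (t : ℝ≥0) :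
    ∫ ω, f (X t ω) ∂μ ≤ gronwallBound (f x₀) β K t := by
  have hLf := hasExpGrowth_generator hm ha hb hf
  have h := le_gronwallBound_of_eq_integral (φ := fun s => ∫ ω, f (X s.toNNReal ω) ∂μ)
    (ψ := fun s => ∫ ω, generator m a b f (X s.toNNReal ω) ∂μ) (φ₀ := f x₀) (β := β) (K := K)
    (T := t) t.2 (hX.intervalIntegrable_of_hasExpGrowth hm ha hb hLf t.2)
    (fun s hs => by
      have := hX.dynkin hm ha hb hf s.toNNReal
      rwa [Real.coe_toNNReal _ hs.1] at this)
    (fun s _ => by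
      have hi := hX.integrable_of_hasExpGrowth hm ha hb hf s.toNNReal
      have e : β * ∫ ω, f (X s.toNNReal ω) ∂μ + K = ∫ ω, (β * f (X s.toNNReal ω) + K) ∂μ := by
        rw [integral_add (hi.const_mul β) (integrable_const K), integral_const_mul]
        simp
      rw [e]
      exact integral_mono (hX.integrable_of_hasExpGrowth hm ha hb hLf _)
        ((hi.const_mul β).add (integrable_const K)) fun ω => hL _ (hX.ordered _ ω))
  simpa using h

/-! ### Maximal inequalities -/

/-- Doob's maximal inequality along an increasing sequence of times, for a bounded nonnegative
function with a one-sided drift bound. -/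
lemma measure_exists_le_of_bounded [IsProbabilityMeasure μ] (hm : ∀ i, 0 < m i)
    (ha : ∀ i, 0 ≤ a i) (hb : ∀ i, 0 ≤ b i) (hX : IsElasticSystem m a b x₀ μ X)
    {f : (Fin N → ℤ) → ℝ} {B : ℝ} (hf0 : ∀ x, 0 ≤ f x) (hfB : ∀ x, f x ≤ B)
    {Λ K : ℝ} (hΛ : 0 ≤ Λ) (hK : 0 ≤ K)
    (hL : ∀ x, Monotone x → generator m a b f x ≤ Λ * f x + K) {A : ℝ} {T : ℝ≥0}
    (hA : ∀ t : ℝ≥0, T ≤ t → t ≤ T + 1 → ∫ ω, f (X t ω) ∂μ ≤ A) {τ : ℕ → ℝ≥0} (hτ : Monotone τ)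
    {n : ℕ} (hτ0 : τ 0 = T) (hτn : τ n = T + 1) {lam : ℝ≥0} (hlam : 0 < lam) :
    μ {ω | ∃ k ≤ n, (lam : ℝ) ≤ f (X (τ k) ω)} ≤ ENNReal.ofReal ((A + (Λ * A + K)) / lam) := by
  have hfb : ∀ x, |f x| ≤ B := fun x => by rw [abs_of_nonneg (hf0 x)]; exact hfB x
  have hLb := abs_generator_le_of_bounded hm ha hb hfb
  set g : (Fin N → ℤ) → ℝ := fun x => Λ * f x + K with hg
  have hg0 : ∀ x, 0 ≤ g x := fun x => add_nonneg (mul_nonneg hΛ (hf0 x)) hK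
  have hgb : ∀ x, |g x| ≤ Λ * B + K := fun x => by
    rw [abs_of_nonneg (hg0 x)]
    exact add_le_add_left (mul_le_mul_of_nonneg_left (hfB x) hΛ) K
  have hTτ : ∀ k, T ≤ τ k := fun k => hτ0 ▸ hτ (Nat.zero_le k)
  set ℱ := Filtration.natural X hX.stronglyMeasurable with hℱ
  let 𝒢 : Filtration ℕ _ := ⟨fun k => ℱ (τ k), fun i j hij => ℱ.mono (hτ hij), fun k => ℱ.le _⟩
  set M : ℝ≥0 → Ω → ℝ :=
    fun t ω => f (X t ω) - ∫ s in (0 : ℝ)..t, generator m a b f (X s.toNNReal ω) with hM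
  have hMart : Martingale M ℱ μ := hX.martingale f ⟨B, hfb⟩
  have hM𝒢 : Martingale (fun k => M (τ k)) 𝒢 μ :=
    ⟨fun k => hMart.1 (τ k), fun i j hij => hMart.2 _ _ (hτ hij)⟩
  have hintL : ∀ t : ℝ≥0, Integrable
      (fun ω => ∫ s in (0 : ℝ)..t, generator m a b f (X s.toNNReal ω)) μ := fun t => by
    refine ((hX.integrable_of_bounded hfb t).sub (hMart.integrable t)).congr
      (ae_of_all _ fun ω => ?_)
    simp [hM]
  have hintg : ∀ k, Integrable (fun ω => ∫ s in (T : ℝ)..τ k, g (X s.toNNReal ω)) μ := fun k => by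
    have hTk : (T : ℝ) ≤ τ k := by exact_mod_cast hTτ k
    refine Integrable.of_bound (C := (Λ * B + K) * |(τ k : ℝ) - T|)
      (stronglyMeasurable_intervalIntegral (hX.measurable_uncurry g) hTk).aestronglyMeasurable
      (ae_of_all _ fun ω => ?_)
    exact intervalIntegral.norm_integral_le_of_norm_le_const fun s _ => by
      simpa using hgb (X s.toNNReal ω)
  -- Adding I to the martingale cancels its compensator up to T and adds the larger rate g after T.
  -- As g ≥ 0, I is nondecreasing and hence a submartingale; as g dominates the generator, the sum Z
  -- dominates f along the path, and Z equals f(X T) at time T.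
  set I : ℕ → Ω → ℝ := fun k ω => (∫ s in (0 : ℝ)..T, generator m a b f (X s.toNNReal ω)) +
    ∫ s in (T : ℝ)..τ k, g (X s.toNNReal ω) with hI
  have hIint : ∀ k, Integrable (I k) μ := fun k => (hintL T).add (hintg k)
  have hImono : ∀ k ω, I k ω ≤ I (k + 1) ω := fun k ω => by
    refine add_le_add_right ?_ _
    have hadd := intervalIntegral.integral_add_adjacent_intervals
      (hX.intervalIntegrable_path hgb ω T (τ k))
      (hX.intervalIntegrable_path hgb ω (τ k) (τ (k + 1)))
    rw [← hadd]
    refine le_add_of_nonneg_right (intervalIntegral.integral_nonneg ?_ fun s _ => hg0 _)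
    exact_mod_cast hτ (Nat.le_succ k)
  have hIad : StronglyAdapted 𝒢 I := fun k => by
    refine StronglyMeasurable.add ?_ ?_
    · exact (hX.stronglyMeasurable_integral_natural _ T.coe_nonneg).mono (ℱ.mono (hTτ k))
    · exact hX.stronglyMeasurable_integral_natural g (by exact_mod_cast hTτ k)
  have hIsub : Submartingale I 𝒢 μ := by
    refine submartingale_nat hIad hIint fun k => ?_
    have h1 : μ[I k | 𝒢 k] = I k := condExp_of_stronglyMeasurable (𝒢.le k) (hIad k) (hIint k)
    calc I k =ᵐ[μ] μ[I k | 𝒢 k] := by rw [h1]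
      _ ≤ᵐ[μ] μ[I (k + 1) | 𝒢 k] :=
        condExp_mono (hIint k) (hIint (k + 1)) (ae_of_all _ fun ω => hImono k ω)
  have hSub := hIsub.add_martingale hM𝒢
  set Z : ℕ → Ω → ℝ := I + fun k => M (τ k) with hZ
  have hZeq : ∀ k ω, Z k ω = f (X (τ k) ω) +
      ∫ s in (T : ℝ)..τ k, (g (X s.toNNReal ω) - generator m a b f (X s.toNNReal ω)) := by
    intro k ω
    have hadd := intervalIntegral.integral_add_adjacent_intervals
      (hX.intervalIntegrable_path hLb ω 0 T) (hX.intervalIntegrable_path hLb ω T (τ k))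
    rw [intervalIntegral.integral_sub (hX.intervalIntegrable_path hgb ω _ _)
      (hX.intervalIntegrable_path hLb ω _ _)]
    simp only [hZ, hI, hM, Pi.add_apply]
    linarith
  have hZf : ∀ k ω, f (X (τ k) ω) ≤ Z k ω := fun k ω => by
    rw [hZeq]
    refine le_add_of_nonneg_right (intervalIntegral.integral_nonneg (by exact_mod_cast hTτ k)
      fun s _ => sub_nonneg.2 (hL _ (hX.ordered _ ω)))
  have hZ0 : 0 ≤ Z := fun k ω => (hf0 _).trans (hZf k ω)
  have hZint : ∫ ω, Z n ω ∂μ ≤ A + (Λ * A + K) := by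
    have e1 : ∫ ω, Z n ω ∂μ = ∫ ω, I n ω ∂μ + ∫ ω, M (τ n) ω ∂μ :=
      integral_add (hIint n) (hM𝒢.integrable n)
    have e2 : ∫ ω, M (τ n) ω ∂μ = ∫ ω, M T ω ∂μ := by
      have := hMart.setIntegral_eq (hTτ n) MeasurableSet.univ
      simpa using this.symm
    have e3 : ∫ ω, M T ω ∂μ = ∫ ω, f (X T ω) ∂μ -
        ∫ ω, (∫ s in (0 : ℝ)..T, generator m a b f (X s.toNNReal ω)) ∂μ :=
      integral_sub (hX.integrable_of_bounded hfb T) (hintL T)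
    have e4 : ∫ ω, I n ω ∂μ =
        ∫ ω, (∫ s in (0 : ℝ)..T, generator m a b f (X s.toNNReal ω)) ∂μ +
        ∫ ω, (∫ s in (T : ℝ)..τ n, g (X s.toNNReal ω)) ∂μ := integral_add (hintL T) (hintg n)
    have e5 : ∫ ω, (∫ s in (T : ℝ)..τ n, g (X s.toNNReal ω)) ∂μ ≤ Λ * A + K := by
      rw [← hX.integral_intervalIntegral_comm hgb, hτn]
      have hle : (T : ℝ) ≤ ((T + 1 : ℝ≥0) : ℝ) := by push_cast; linarith
      calc _ ≤ ∫ _ in (T : ℝ)..((T + 1 : ℝ≥0) : ℝ), (Λ * A + K) := by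
            refine intervalIntegral.integral_mono_on hle
              (hX.intervalIntegrable_integral_comp hgb _ _) (by simp) fun s hs => ?_
            simp only [hg]
            rw [integral_add ((hX.integrable_of_bounded hfb _).const_mul Λ) (integrable_const K),
              integral_const_mul, integral_const, probReal_univ, one_smul]
            refine add_le_add_left (mul_le_mul_of_nonneg_left (hA _ ?_ ?_) hΛ) K
            · exact NNReal.le_toNNReal_of_coe_le hs.1
            · exact Real.toNNReal_le_iff_le_coe.2 hs.2
        _ = Λ * A + K := by
            rw [intervalIntegral.integral_const]; push_cast; simp
    have e6 := hA T le_rfl (by simp)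
    linarith
  have hmax := maximal_ineq hSub hZ0 (ε := lam) n
  have hset : {ω | ∃ k ≤ n, (lam : ℝ) ≤ f (X (τ k) ω)} ⊆
      {ω | (lam : ℝ) ≤ (Finset.range (n + 1)).sup' Finset.nonempty_range_add_one fun k => Z k ω} := by
    rintro ω ⟨k, hk, h⟩
    refine (h.trans (hZf k ω)).trans ?_
    exact Finset.le_sup' (fun k => Z k ω) (Finset.mem_range.2 (by omega))
  have hfin : ENNReal.ofReal (∫ ω in {ω | (lam : ℝ) ≤
      (Finset.range (n + 1)).sup' Finset.nonempty_range_add_one fun k => Z k ω}, Z n ω ∂μ) ≤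
      ENNReal.ofReal (A + (Λ * A + K)) :=
    ENNReal.ofReal_le_ofReal ((setIntegral_le_integral (hSub.integrable n)
      (ae_of_all _ fun ω => hZ0 n ω)).trans hZint)
  rw [ENNReal.ofReal_div_of_pos (by exact_mod_cast hlam), ENNReal.ofReal_coe_nnreal,
    ENNReal.le_div_iff_mul_le (by simp [hlam.ne']) (by simp), mul_comm]
  exact (mul_le_mul_right (measure_mono hset) _).trans (hmax.trans hfin)

/-- A maximal inequality over unit time intervals. -/
lemma measure_exists_mem_Ico_le [IsProbabilityMeasure μ] (hm : ∀ i, 0 < m i)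
    (ha : ∀ i, 0 ≤ a i) (hb : ∀ i, 0 ≤ b i) (hX : IsElasticSystem m a b x₀ μ X)
    {f : (Fin N → ℤ) → ℝ} (hf : HasExpGrowth f) (hf0 : ∀ x, 0 ≤ f x)
    {Λ K : ℝ} (hΛ : 0 ≤ Λ) (hK : 0 ≤ K)
    (hL : ∀ x, Monotone x → generator m a b f x ≤ Λ * f x + K) {A : ℝ} {T : ℝ≥0}
    (hA : ∀ t : ℝ≥0, T ≤ t → t ≤ T + 1 → ∫ ω, f (X t ω) ∂μ ≤ A) {lam : ℝ} (hlam : 0 < lam) :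
    μ {ω | ∃ t : ℝ≥0, T ≤ t ∧ t < T + 1 ∧ lam ≤ f (X t ω)} ≤
      ENNReal.ofReal ((A + (Λ * A + K)) / lam) := by
  lift lam to ℝ≥0 using hlam.le
  -- Truncation at the level itself leaves the event {lam ≤ f} unchanged and makes the function
  -- bounded.
  set g : (Fin N → ℤ) → ℝ := fun x => min (f x) lam with hg
  have hg0 : ∀ x, 0 ≤ g x := fun x => le_min (hf0 x) lam.coe_nonneg
  have hgl : ∀ x, g x ≤ lam := fun x => min_le_right _ _
  have hLg : ∀ x, Monotone x → generator m a b g x ≤ Λ * g x + K := fun x hx => by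
    refine (generator_min_le hm ha hb f lam x).trans ?_
    split_ifs with h
    · simp only [hg, min_eq_left h]; exact hL x hx
    · exact add_nonneg (mul_nonneg hΛ (hg0 x)) hK
  have hgA : ∀ t : ℝ≥0, T ≤ t → t ≤ T + 1 → ∫ ω, g (X t ω) ∂μ ≤ A := fun t h1 h2 =>
    (integral_mono (hX.integrable_of_bounded (K := lam)
      (fun x => by rw [abs_of_nonneg (hg0 x)]; exact hgl x) t)
      (hX.integrable_of_hasExpGrowth hm ha hb hf t) fun ω => min_le_left _ _).trans (hA t h1 h2)
  set τ : ℕ → ℕ → ℝ≥0 := fun n k => T + k / 2 ^ n with hτ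
  set E : ℕ → Set Ω := fun n => {ω | ∃ k ≤ 2 ^ n, (lam : ℝ) ≤ g (X (τ n k) ω)} with hE
  have hEμ : ∀ n, μ (E n) ≤ ENNReal.ofReal ((A + (Λ * A + K)) / lam) := fun n => by
    refine hX.measure_exists_le_of_bounded hm ha hb hg0 hgl hΛ hK hLg hgA (τ := τ n) ?_ ?_ ?_
      (by exact_mod_cast hlam)
    · intro i j hij
      simp only [hτ]
      gcongr
    · simp [hτ]
    · simp [hτ]
  have hEmono : Monotone E := by
    refine monotone_nat_of_le_succ fun n ω => ?_
    rintro ⟨k, hk, h⟩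
    refine ⟨2 * k, by rw [pow_succ]; omega, ?_⟩
    have : τ (n + 1) (2 * k) = τ n k := by
      simp only [hτ]
      push_cast
      rw [pow_succ, mul_comm (2 : ℝ≥0) k, mul_div_mul_right _ _ two_ne_zero]
    rwa [this]
  -- The path is constant on some [t, u). Once the dyadic mesh is below u - t, rounding t up stays
  -- in this interval, and t < T + 1 keeps the rounded index at most `2 ^ n`.
  have hsub : {ω | ∃ t : ℝ≥0, T ≤ t ∧ t < T + 1 ∧ (lam : ℝ) ≤ f (X t ω)} ⊆ ⋃ n, E n := by
    rintro ω ⟨t, h1, h2, h3⟩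
    obtain ⟨u, hu, hu'⟩ := (mem_nhdsGE_iff_exists_Ico_subset).1 (hX.rightCont ω t)
    obtain ⟨n, hn⟩ := exists_pow_lt_of_lt_one (tsub_pos_of_lt (Set.mem_Ioi.1 hu))
      (show (1 / 2 : ℝ≥0) < 1 from NNReal.half_lt_self one_ne_zero)
    have h2n : (0 : ℝ≥0) < 2 ^ n := by positivity
    refine Set.mem_iUnion.2 ⟨n, ⌈(t - T) * 2 ^ n⌉₊, ?_, ?_⟩
    · refine Nat.ceil_le.2 ?_
      push_cast
      refine mul_le_of_le_one_left h2n.le ?_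
      exact tsub_le_iff_left.2 h2.le
    · have hge : t ≤ τ n ⌈(t - T) * 2 ^ n⌉₊ := by
        simp only [hτ]
        refine tsub_le_iff_left.1 ?_
        rw [le_div_iff₀ h2n]
        exact Nat.le_ceil _
      have hlt : τ n ⌈(t - T) * 2 ^ n⌉₊ < u := by
        have h4 : (⌈(t - T) * 2 ^ n⌉₊ : ℝ≥0) / 2 ^ n ≤ (t - T) + (1 / 2) ^ n := by
          rw [div_le_iff₀ h2n, add_mul, ← mul_pow]
          have h5 := (Nat.ceil_lt_add_one (zero_le : 0 ≤ (t - T) * 2 ^ n)).le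
          simpa using h5
        calc τ n ⌈(t - T) * 2 ^ n⌉₊ ≤ T + ((t - T) + (1 / 2) ^ n) := add_le_add_right h4 T
          _ = t + (1 / 2) ^ n := by rw [← add_assoc, add_tsub_cancel_of_le h1]
          _ < t + (u - t) := (add_lt_add_iff_left t).2 hn
          _ = u := add_tsub_cancel_of_le (Set.mem_Ioi.1 hu).le
      have hXeq : X (τ n ⌈(t - T) * 2 ^ n⌉₊) ω = X t ω := hu' ⟨hge, hlt⟩
      rw [hXeq]
      exact le_min h3 le_rfl
  refine (measure_mono hsub).trans ?_
  rw [hEmono.measure_iUnion]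
  exact iSup_le hEμ

end IsElasticSystem

/-! ### Growth of the test functions -/

lemma hasExpGrowth_lyapunov [NeZero N] (hm : ∀ i, 0 < m i) {θ : ℝ} (hθ : 0 ≤ θ) :
    HasExpGrowth (lyapunov m θ) := by
  refine ⟨θ * (√(massSum m N) * 2), Real.exp θ, by positivity, (Real.exp_pos θ).le, fun x => ?_⟩
  rw [lyapunov, abs_of_pos (Real.exp_pos _)]
  refine (lyapunov_le_exp_span hm hθ x).trans ?_
  rw [expNorm, ← Real.exp_add]
  refine Real.exp_le_exp.2 ?_
  have h := mul_le_mul_of_nonneg_left (span_le_two_mul_sum_abs x)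
    (mul_nonneg hθ (Real.sqrt_nonneg (massSum m N)))
  linarith

lemma abs_wsum_le (w : Fin N → ℝ) (x : Fin N → ℤ) :
    |wsum w x| ≤ (∑ i, |w i|) * ∑ i, |(x i : ℝ)| := by
  unfold wsum
  refine (Finset.abs_sum_le_sum_abs _ _).trans ?_
  rw [Finset.sum_mul]
  refine Finset.sum_le_sum fun i _ => ?_
  rw [abs_mul]
  exact mul_le_mul_of_nonneg_left (Finset.single_le_sum (f := fun i => |(x i : ℝ)|)
    (fun _ _ => abs_nonneg _) (Finset.mem_univ i)) (abs_nonneg _)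

lemma hasExpGrowth_exp_wsum (w : Fin N → ℝ) (θ : ℝ) :
    HasExpGrowth fun x => Real.exp (θ * wsum w x) := by
  refine ⟨|θ| * ∑ i, |w i|, 1, by positivity, zero_le_one, fun x => ?_⟩
  rw [abs_of_pos (Real.exp_pos _), one_mul, expNorm]
  refine Real.exp_le_exp.2 ((le_abs_self _).trans ?_)
  rw [abs_mul, mul_assoc]
  exact mul_le_mul_of_nonneg_left (abs_wsum_le w x) (abs_nonneg θ)

lemma hasExpGrowth_wsum_sq (w : Fin N → ℝ) : HasExpGrowth fun x => wsum w x ^ 2 := by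
  refine ⟨∑ i, |w i|, 2, by positivity, two_pos.le, fun x => ?_⟩
  have h := abs_wsum_le w x
  have h0 : 0 ≤ (∑ i, |w i|) * ∑ i, |(x i : ℝ)| := (abs_nonneg _).trans h
  have h2 := Real.quadratic_le_exp_of_nonneg h0
  have h3 : |wsum w x| ^ 2 ≤ ((∑ i, |w i|) * ∑ i, |(x i : ℝ)|) ^ 2 := by gcongr
  rw [sq_abs] at h3
  rw [abs_of_nonneg (sq_nonneg _), expNorm]
  linarith

lemma tendsto_coe_inv_atTop : Tendsto (fun t : ℝ≥0 => ((t : ℝ))⁻¹) atTop (𝓝 0) :=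
  tendsto_inv_atTop_zero.comp (NNReal.tendsto_coe_atTop.2 tendsto_id)

/-! ### Long-time behaviour by Borel–Cantelli -/

namespace IsElasticSystem

/-- A geometric drift condition bounds the expectation uniformly in time. -/
lemma integral_le_of_drift [IsProbabilityMeasure μ] (hm : ∀ i, 0 < m i) (ha : ∀ i, 0 ≤ a i)
    (hb : ∀ i, 0 ≤ b i) (hX : IsElasticSystem m a b x₀ μ X) {f : (Fin N → ℤ) → ℝ}
    (hf : HasExpGrowth f) (hf0 : ∀ x, 0 ≤ f x) {κ K : ℝ} (hκ : 0 < κ) (hK : 0 ≤ K)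
    (hL : ∀ x, Monotone x → generator m a b f x ≤ -κ * f x + K) (t : ℝ≥0) :
    ∫ ω, f (X t ω) ∂μ ≤ f x₀ + K / κ := by
  refine (hX.integral_le_gronwallBound hm ha hb hf hL t).trans ?_
  rw [gronwallBound_of_K_ne_0 (neg_ne_zero.2 hκ.ne')]
  have h1 : Real.exp (-κ * t) ≤ 1 := Real.exp_le_one_iff.2 (by
    have := mul_nonneg hκ.le t.coe_nonneg; linarith)
  have h2 := Real.exp_pos (-κ * t)
  have h3 := mul_le_mul_of_nonneg_left h1 (hf0 x₀)
  have h4 : K / -κ * (Real.exp (-κ * t) - 1) = K / κ * (1 - Real.exp (-κ * t)) := by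
    rw [div_neg]; ring
  have h5 : K / κ * (1 - Real.exp (-κ * t)) ≤ K / κ * 1 :=
    mul_le_mul_of_nonneg_left (by linarith) (div_nonneg hK hκ.le)
  simp only
  rw [h4]
  linarith

/-- Almost surely, a nonnegative function with uniformly bounded expectation and drift is
eventually at most `(⌊t⌋ + 1) ^ 2`. -/
lemma ae_eventually_lt_sq [IsProbabilityMeasure μ] (hm : ∀ i, 0 < m i) (ha : ∀ i, 0 ≤ a i)
    (hb : ∀ i, 0 ≤ b i) (hX : IsElasticSystem m a b x₀ μ X) {f : (Fin N → ℤ) → ℝ}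
    (hf : HasExpGrowth f) (hf0 : ∀ x, 0 ≤ f x) {K A : ℝ} (hK : 0 ≤ K)
    (hL : ∀ x, Monotone x → generator m a b f x ≤ K) (hA : ∀ t, ∫ ω, f (X t ω) ∂μ ≤ A) :
    ∀ᵐ ω ∂μ, ∀ᶠ t : ℝ≥0 in atTop, f (X t ω) ≤ ((t : ℝ) + 1) ^ 2 := by
  have hA0 : 0 ≤ A := (integral_nonneg fun ω => hf0 (X 0 ω)).trans (hA 0)
  -- The quadratic threshold makes the maximal bounds summable over the unit intervals.
  set E : ℕ → Set Ω := fun n =>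
    {ω | ∃ t : ℝ≥0, (n : ℝ≥0) ≤ t ∧ t < n + 1 ∧ ((n : ℝ) + 1) ^ 2 ≤ f (X t ω)} with hE
  have hEμ : ∀ n, μ (E n) ≤ ENNReal.ofReal ((A + K) * (1 / ((n : ℝ) + 1) ^ 2)) := fun n => by
    have h := hX.measure_exists_mem_Ico_le hm ha hb hf hf0 le_rfl hK (Λ := 0)
      (fun x hx => by rw [zero_mul, zero_add]; exact hL x hx) (A := A) (T := n)
      (fun t _ _ => hA t) (lam := ((n : ℝ) + 1) ^ 2) (by positivity)
    rw [zero_mul, zero_add] at h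
    rwa [mul_one_div]
  have hsum : ∑' n, μ (E n) ≠ ⊤ := by
    have hs : Summable fun n : ℕ => (A + K) * (1 / ((n : ℝ) + 1) ^ 2) := by
      refine Summable.mul_left _ ?_
      have := (summable_nat_add_iff 1).2 (Real.summable_one_div_nat_pow.2 one_lt_two)
      simpa using this
    refine ne_top_of_le_ne_top ?_ (ENNReal.tsum_le_tsum hEμ)
    rw [← ENNReal.ofReal_tsum_of_nonneg (fun n => by positivity) hs]
    exact ENNReal.ofReal_ne_top
  filter_upwards [ae_eventually_notMem hsum] with ω hω
  filter_upwards [(tendsto_nat_floor_atTop (α := ℝ≥0)).eventually hω] with t ht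
  by_contra hcon
  push Not at hcon
  have hle : (⌊t⌋₊ : ℝ≥0) ≤ t := Nat.floor_le (zero_le)
  refine ht ⟨t, hle, Nat.lt_floor_add_one t, le_trans ?_ hcon.le⟩
  have : ((⌊t⌋₊ : ℝ≥0) : ℝ) ≤ t := by exact_mod_cast hle
  rw [NNReal.coe_natCast] at this
  gcongr

/-- A one-sided bound in the law of large numbers for the momentum. -/
lemma ae_eventually_momentum_le [NeZero N] [IsProbabilityMeasure μ] (hm : ∀ i, 0 < m i)
    (ha : ∀ i, 0 ≤ a i) (hb : ∀ i, 0 ≤ b i) (hX : IsElasticSystem m a b x₀ μ X) {σ : ℝ}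
    (hσ : |σ| = 1) {ε : ℝ} (hε : 0 < ε) :
    ∀ᵐ ω ∂μ, ∀ᶠ t : ℝ≥0 in atTop,
      σ * (wsum m (X t ω) + potSum m a b N * t) ≤ ε * t + |potSum m a b N| := by
  set U := potSum m a b N with hU
  set B := massSum m N with hBdef
  have hBpos : 0 < B := massSum_pos hm
  have hB : ∀ i, m i ≤ B := mass_le_massSum hm
  have hR := rateBound_nonneg hm ha hb
  set R := rateBound m a b with hRdef
  -- The quadratic error in the exponential growth rate is made at most ηε/2, half of the excess ηε
  -- in the threshold below; the other half gives the geometric decay of `μ (E n)`.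
  obtain ⟨η, hη, hη1, hη2⟩ : ∃ η : ℝ, 0 < η ∧ η * B ≤ 1 ∧ R * B ^ 2 * η ≤ ε / 2 := by
    refine ⟨min B⁻¹ (ε / 2 / (R * B ^ 2 + 1)), by positivity, ?_, ?_⟩
    · calc _ ≤ B⁻¹ * B := mul_le_mul_of_nonneg_right (min_le_left _ _) hBpos.le
        _ = 1 := inv_mul_cancel₀ hBpos.ne'
    · calc _ ≤ R * B ^ 2 * (ε / 2 / (R * B ^ 2 + 1)) :=
            mul_le_mul_of_nonneg_left (min_le_right _ _) (by positivity)
        _ ≤ (R * B ^ 2 + 1) * (ε / 2 / (R * B ^ 2 + 1)) :=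
            mul_le_mul_of_nonneg_right (by linarith) (by positivity)
        _ = ε / 2 := by field_simp
  set θ := σ * η with hθ
  have hθabs : |θ| = η := by rw [hθ, abs_mul, hσ, one_mul, abs_of_pos hη]
  set β := -θ * U + R * (η * B) ^ 2 with hβ
  set f : (Fin N → ℤ) → ℝ := fun x => Real.exp (θ * wsum m x) with hf
  have hf0 : ∀ x, 0 ≤ f x := fun x => (Real.exp_pos _).le
  have hfg : HasExpGrowth f := hasExpGrowth_exp_wsum m θ
  have hL : ∀ x, Monotone x → generator m a b f x ≤ β * f x := fun x hx => by
    have := generator_exp_wsum_le hm ha hb (θ := θ) hB (by rw [hθabs]; exact hη1) hx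
    rwa [hθabs] at this
  have hE1 : ∀ t : ℝ≥0, ∫ ω, f (X t ω) ∂μ ≤ f x₀ * Real.exp (β * t) := fun t => by
    have := hX.integral_le_gronwallBound hm ha hb hfg (β := β) (K := 0)
      (fun x hx => by rw [add_zero]; exact hL x hx) t
    rwa [gronwallBound_ε0] at this
  set D := f x₀ * Real.exp |β| * (1 + |β|) with hD
  have hD0 : 0 ≤ D := mul_nonneg (mul_nonneg (hf0 _) (Real.exp_pos _).le) (by positivity)
  set E : ℕ → Set Ω := fun n =>
    {ω | ∃ t : ℝ≥0, (n : ℝ≥0) ≤ t ∧ t < n + 1 ∧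
      Real.exp ((-θ * U + η * ε) * n) ≤ f (X t ω)} with hE
  have hEμ : ∀ n : ℕ, μ (E n) ≤ ENNReal.ofReal (D * Real.exp (-(η * ε / 2)) ^ n) := fun n => by
    have h := hX.measure_exists_mem_Ico_le hm ha hb hfg hf0 (abs_nonneg β) le_rfl (K := 0)
      (fun x hx => by
        rw [add_zero]
        exact (hL x hx).trans (mul_le_mul_of_nonneg_right (le_abs_self β) (hf0 x)))
      (A := f x₀ * Real.exp (β * n + |β|)) (T := n)
      (fun t h1 h2 => by
        refine (hE1 t).trans (mul_le_mul_of_nonneg_left (Real.exp_le_exp.2 ?_) (hf0 _))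
        have h1' : (n : ℝ) ≤ t := by exact_mod_cast h1
        have h2' : (t : ℝ) ≤ n + 1 := by exact_mod_cast h2
        have h3 : β * (t - n) ≤ |β| * (t - n) :=
          mul_le_mul_of_nonneg_right (le_abs_self β) (by linarith)
        have h4 : |β| * (t - n) ≤ |β| * 1 := mul_le_mul_of_nonneg_left (by linarith) (abs_nonneg β)
        linarith)
      (lam := Real.exp ((-θ * U + η * ε) * n)) (Real.exp_pos _)
    refine h.trans (ENNReal.ofReal_le_ofReal ?_)
    rw [div_le_iff₀ (Real.exp_pos _), add_zero, ← Real.exp_nat_mul]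
    have e1 : f x₀ * Real.exp (β * n + |β|) + |β| * (f x₀ * Real.exp (β * n + |β|)) =
        D * Real.exp (β * n) := by
      rw [hD, Real.exp_add]; ring
    rw [e1, mul_assoc D, ← Real.exp_add]
    refine mul_le_mul_of_nonneg_left (Real.exp_le_exp.2 ?_) hD0
    have h5 : R * (η * B) ^ 2 ≤ η * ε / 2 := by
      have := mul_le_mul_of_nonneg_left hη2 hη.le
      calc R * (η * B) ^ 2 = η * (R * B ^ 2 * η) := by ring
        _ ≤ _ := by linarith
    have h6 := mul_le_mul_of_nonneg_right h5 (Nat.cast_nonneg (α := ℝ) n)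
    rw [hβ]
    linarith
  have hsum : ∑' n, μ (E n) ≠ ⊤ := by
    have hs : Summable fun n : ℕ => D * Real.exp (-(η * ε / 2)) ^ n :=
      (summable_geometric_of_lt_one (Real.exp_pos _).le
        (Real.exp_lt_one_iff.2 (by have := mul_pos hη hε; linarith))).mul_left _
    refine ne_top_of_le_ne_top ?_ (ENNReal.tsum_le_tsum hEμ)
    rw [← ENNReal.ofReal_tsum_of_nonneg
      (fun n => mul_nonneg hD0 (pow_nonneg (Real.exp_pos _).le n)) hs]
    exact ENNReal.ofReal_ne_top
  filter_upwards [ae_eventually_notMem hsum] with ω hω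
  filter_upwards [(tendsto_nat_floor_atTop (α := ℝ≥0)).eventually hω] with t ht
  have hle : (⌊t⌋₊ : ℝ≥0) ≤ t := Nat.floor_le (zero_le)
  have hlt : t < (⌊t⌋₊ : ℝ≥0) + 1 := Nat.lt_floor_add_one t
  have hcon : ¬ Real.exp ((-θ * U + η * ε) * ⌊t⌋₊) ≤ f (X t ω) := fun h => ht ⟨t, hle, hlt, h⟩
  simp only [hf] at hcon
  rw [Real.exp_le_exp, not_le, hθ] at hcon
  have hle' : (⌊t⌋₊ : ℝ) ≤ t := by exact_mod_cast hle
  have hlt' : (t : ℝ) < ⌊t⌋₊ + 1 := by exact_mod_cast hlt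
  have h1 : σ * wsum m (X t ω) < (-σ * U + ε) * ⌊t⌋₊ := by
    refine lt_of_mul_lt_mul_left ?_ hη.le
    linarith
  have h2 : σ * U * (t - ⌊t⌋₊) ≤ |U| := by
    have h3 : σ * U ≤ |U| := by
      refine (le_abs_self _).trans ?_
      rw [abs_mul, hσ, one_mul]
    calc σ * U * (t - ⌊t⌋₊) ≤ |U| * (t - ⌊t⌋₊) :=
          mul_le_mul_of_nonneg_right h3 (by linarith)
      _ ≤ |U| * 1 := mul_le_mul_of_nonneg_left (by linarith) (abs_nonneg U)
      _ = |U| := mul_one _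
  have h4 : ε * ⌊t⌋₊ ≤ ε * t := mul_le_mul_of_nonneg_left hle' hε.le
  linarith

/-- The law of large numbers for the momentum. -/
lemma ae_tendsto_momentum [NeZero N] [IsProbabilityMeasure μ] (hm : ∀ i, 0 < m i)
    (ha : ∀ i, 0 ≤ a i) (hb : ∀ i, 0 ≤ b i) (hX : IsElasticSystem m a b x₀ μ X) :
    ∀ᵐ ω ∂μ, Tendsto (fun t : ℝ≥0 => wsum m (X t ω) / t) atTop (𝓝 (-potSum m a b N)) := by
  have h1 : ∀ᵐ ω ∂μ, ∀ j : ℕ, ∀ᶠ t : ℝ≥0 in atTop,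
      1 * (wsum m (X t ω) + potSum m a b N * t) ≤ 1 / ((j : ℝ) + 1) * t + |potSum m a b N| :=
    ae_all_iff.2 fun j => hX.ae_eventually_momentum_le hm ha hb (by simp) (by positivity)
  have h2 : ∀ᵐ ω ∂μ, ∀ j : ℕ, ∀ᶠ t : ℝ≥0 in atTop,
      -1 * (wsum m (X t ω) + potSum m a b N * t) ≤ 1 / ((j : ℝ) + 1) * t + |potSum m a b N| :=
    ae_all_iff.2 fun j => hX.ae_eventually_momentum_le hm ha hb (by simp) (by positivity)
  filter_upwards [h1, h2] with ω hω1 hω2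
  rw [Metric.tendsto_nhds]
  intro ε hε
  obtain ⟨j, hj⟩ := exists_nat_one_div_lt (half_pos hε)
  have h3 : ∀ᶠ t : ℝ≥0 in atTop, |potSum m a b N| * ((t : ℝ))⁻¹ < ε / 2 := by
    have := tendsto_coe_inv_atTop.const_mul |potSum m a b N|
    rw [mul_zero] at this
    exact this.eventually_lt_const (half_pos hε)
  filter_upwards [hω1 j, hω2 j, h3, eventually_gt_atTop 0] with t ht1 ht2 ht3 ht0
  have ht : (0 : ℝ) < t := by exact_mod_cast ht0
  rw [Real.dist_eq, sub_neg_eq_add]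
  have e : wsum m (X t ω) / t + potSum m a b N =
      (wsum m (X t ω) + potSum m a b N * t) / t := by field_simp
  rw [e, abs_div, abs_of_pos ht, div_lt_iff₀ ht]
  rw [← div_eq_mul_inv, div_lt_iff₀ ht] at ht3
  have h4 := mul_lt_mul_of_pos_right hj ht
  rw [abs_lt]
  constructor <;> linarith

/-- The span grows at most logarithmically if its exponential grows at most quadratically. -/
lemma logarithmicGrowth_of_ae [NeZero N] {δ : ℝ} (hδ : 0 < δ)
    (h : ∀ᵐ ω ∂μ, ∀ᶠ t : ℝ≥0 in atTop,
      Real.exp (δ * span (X t ω)) ≤ ((t : ℝ) + 1) ^ 2) : LogarithmicGrowth μ X := by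
  filter_upwards [h] with ω hω
  refine lt_of_le_of_lt (b := ((4 / δ : ℝ) : EReal)) ?_ (EReal.coe_lt_top _)
  refine limsup_le_of_le (by isBoundedDefault) ?_
  filter_upwards [hω, eventually_ge_atTop 2] with t ht ht2
  have ht2' : (2 : ℝ) ≤ t := by exact_mod_cast ht2
  have hlog : 0 < Real.log t := Real.log_pos (by linarith)
  refine EReal.coe_le_coe_iff.2 ?_
  rw [div_le_iff₀ hlog]
  exact le_log_of_exp_le_sq hδ ht2' ht

end IsElasticSystem

/-! ### Tails and moments of the span -/

/-- A uniform moment bound for a function dominating `exp (δ * span)` gives exponential tails. -/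
lemma measureReal_le_span_le [NeZero N] [IsProbabilityMeasure μ] {f : (Fin N → ℤ) → ℝ} {δ A : ℝ}
    (hδ : 0 < δ) (hf : ∀ x, Real.exp (δ * span x) ≤ f x) {t : ℝ≥0}
    (hint : Integrable (fun ω => f (X t ω)) μ) (hA : ∫ ω, f (X t ω) ∂μ ≤ A) (s : ℝ) :
    μ.real {ω | s ≤ (span (X t ω) : ℝ)} ≤ A * Real.exp (-δ * s) := by
  have h := mul_meas_ge_le_integral_of_nonneg
    (ae_of_all μ fun ω => (Real.exp_pos _).le.trans (hf (X t ω))) hint (Real.exp (δ * s))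
  have hsub : {ω | s ≤ (span (X t ω) : ℝ)} ⊆ {ω | Real.exp (δ * s) ≤ f (X t ω)} := fun ω hω =>
    (Real.exp_le_exp.2 (mul_le_mul_of_nonneg_left hω hδ.le)).trans (hf _)
  have h2 : μ.real {ω | s ≤ (span (X t ω) : ℝ)} ≤ μ.real {ω | Real.exp (δ * s) ≤ f (X t ω)} :=
    measureReal_mono hsub
  rw [neg_mul, Real.exp_neg, ← div_eq_mul_inv, le_div_iff₀ (Real.exp_pos _), mul_comm]
  exact (mul_le_mul_of_nonneg_left h2 (Real.exp_pos _).le).trans (h.trans hA)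

/-- Exponential tails bound the second moment of the span. -/
lemma lintegral_span_sq_le [NeZero N] [IsProbabilityMeasure μ] {D δ : ℝ} (hD : 0 ≤ D) (hδ : 0 < δ)
    {t : ℝ≥0} (hX : StronglyMeasurable (X t))
    (h : ∀ s : ℝ, 0 ≤ s → μ.real {ω | s ≤ (span (X t ω) : ℝ)} ≤ D * Real.exp (-δ * s)) :
    ∫⁻ ω, ENNReal.ofReal ((span (X t ω) : ℝ) ^ 2) ∂μ ≤
      ENNReal.ofReal (∑' j : ℕ, (2 * (j : ℝ) + 1) * (D * Real.exp (-δ * j))) := by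
  set E : ℕ → Set Ω := fun j => {ω | (j : ℝ) ≤ (span (X t ω) : ℝ)} with hE
  have hEm : ∀ j, MeasurableSet (E j) := fun j =>
    measurableSet_le measurable_const
      ((Measurable.of_discrete (f := fun x : Fin N → ℤ => (span x : ℝ))).comp hX.measurable)
  have hpt : ∀ ω, ENNReal.ofReal ((span (X t ω) : ℝ) ^ 2) ≤
      ∑' j : ℕ, (E j).indicator (fun _ => ENNReal.ofReal (2 * (j : ℝ) + 1)) ω := by
    intro ω
    obtain ⟨k, hk⟩ := Int.eq_ofNat_of_zero_le (span_nonneg (X t ω))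
    -- Discrete layer-cake formula: a square is a sum of consecutive odd numbers, so the second
    -- moment of the integer-valued span is controlled by the weighted sum of its tails.
    have hsq : ∀ k : ℕ, (k : ℝ) ^ 2 = ∑ j ∈ Finset.range k, (2 * (j : ℝ) + 1) := by
      intro k
      induction k with
      | zero => simp
      | succ k ih => rw [Finset.sum_range_succ, ← ih]; push_cast; ring
    rw [hk, Int.cast_natCast, hsq, ENNReal.ofReal_sum_of_nonneg (fun j _ => by positivity)]
    refine le_trans (Finset.sum_le_sum fun j hj => ?_) (ENNReal.sum_le_tsum (Finset.range k))
    rw [Set.indicator_of_mem]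
    simp only [hE, Set.mem_ofPred_eq]
    rw [hk, Int.cast_natCast]
    exact_mod_cast (Finset.mem_range.1 hj).le
  have hs : Summable fun j : ℕ => (2 * (j : ℝ) + 1) * (D * Real.exp (-δ * j)) := by
    have h1 := (Real.summable_pow_mul_exp_neg_nat_mul 1 hδ).mul_left (2 * D)
    have h0 := (Real.summable_pow_mul_exp_neg_nat_mul 0 hδ).mul_left D
    refine (h1.add h0).congr fun j => ?_
    ring
  calc ∫⁻ ω, ENNReal.ofReal ((span (X t ω) : ℝ) ^ 2) ∂μ
      ≤ ∫⁻ ω, ∑' j : ℕ, (E j).indicator (fun _ => ENNReal.ofReal (2 * (j : ℝ) + 1)) ω ∂μ :=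
        lintegral_mono hpt
    _ = ∑' j : ℕ, ENNReal.ofReal (2 * (j : ℝ) + 1) * μ (E j) := by
        rw [lintegral_tsum fun j => (measurable_const.indicator (hEm j)).aemeasurable]
        exact tsum_congr fun j => lintegral_indicator_const (hEm j) _
    _ ≤ ∑' j : ℕ, ENNReal.ofReal ((2 * (j : ℝ) + 1) * (D * Real.exp (-δ * j))) := by
        refine ENNReal.tsum_le_tsum fun j => ?_
        rw [ENNReal.ofReal_mul (by positivity)]
        refine mul_le_mul_right ?_ _
        rw [← ofReal_measureReal]
        exact ENNReal.ofReal_le_ofReal (h j (Nat.cast_nonneg j))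
    _ = _ := (ENNReal.ofReal_tsum_of_nonneg (fun j => by positivity) hs).symm

/-- Coefficients of total zero make `wsum w` translation invariant, so positions may be measured
from particle 0. -/
lemma abs_wsum_le_span [NeZero N] {w : Fin N → ℝ} (hw : ∑ i, w i = 0) (x : Fin N → ℤ) :
    |wsum w x| ≤ (∑ i, |w i|) * span x := by
  have e : wsum w x = ∑ i, w i * ((x i : ℝ) - x 0) := by
    simp_rw [mul_sub]
    rw [Finset.sum_sub_distrib, ← Finset.sum_mul, hw]
    simp [wsum]
  rw [e, Finset.sum_mul]
  refine (Finset.abs_sum_le_sum_abs _ _).trans (Finset.sum_le_sum fun i _ => ?_)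
  rw [abs_mul]
  refine mul_le_mul_of_nonneg_left ?_ (abs_nonneg _)
  have h1 : ((x i - x 0 : ℤ) : ℝ) ≤ span x := by exact_mod_cast sub_le_span x i 0
  have h2 : ((x 0 - x i : ℤ) : ℝ) ≤ span x := by exact_mod_cast sub_le_span x 0 i
  push_cast at h1 h2
  rw [abs_le]
  constructor <;> linarith

/-! ### The two implications -/

/-- The stability condition is sufficient. -/
lemma exists_stability_constants [NeZero N] (hm : ∀ i, 0 < m i) (ha : ∀ i, 0 ≤ a i)
    (hb : ∀ i, 0 ≤ b i) (h : StabilityCondition m a b) :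
    ∃ C δ : ℝ, 0 ≤ C ∧ 0 < δ ∧
      ∀ (Ω : Type*) [MeasurableSpace Ω] (μ : Measure Ω) [IsProbabilityMeasure μ]
        (x₀ : Fin N → ℤ) (X : ℝ≥0 → Ω → Fin N → ℤ), IsElasticSystem m a b x₀ μ X →
          (∀ i : Fin N, ∀ᵐ ω ∂μ, Tendsto (fun t : ℝ≥0 => (X t ω i : ℝ) / (t : ℝ)) atTop
            (𝓝 (-(potSum m a b N / massSum m N)))) ∧
          ExponentialTails C δ x₀ μ X ∧ LogarithmicGrowth μ X := by
  obtain ⟨θ, κ, K, hθ, hκ, hK, hL⟩ := exists_generator_lyapunov_le hm ha hb h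
  obtain ⟨c, hc, hcm⟩ := exists_pos_le_of_forall_pos Finset.univ m fun i _ => hm i
  have hM := massSum_pos hm
  set δ := θ * (√c / 2) with hδdef
  have hδ : 0 < δ := by positivity
  -- One constant plays three roles: it dominates the prefactor exp θ of the initial Lyapunov value,
  -- the stationary term K/κ, and the exponent θ√M of the initial span.
  set C := Real.exp θ + K / κ + θ * √(massSum m N) with hC
  have hK' : 0 ≤ K / κ := div_nonneg hK hκ.le
  have hC0 : 0 ≤ C := by positivity
  have hfV : ∀ x, Real.exp (δ * span x) ≤ lyapunov m θ x := fun x =>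
    exp_span_le_lyapunov hm hc (fun i => hcm i (Finset.mem_univ i)) hθ.le x
  have hV0 : ∀ x, 0 ≤ lyapunov m θ x := fun x => (Real.exp_pos _).le
  have hVg := hasExpGrowth_lyapunov hm hθ.le
  refine ⟨C, δ, hC0, hδ, fun Ω _ μ _ x₀ X hX => ?_⟩
  have hE := hX.integral_le_of_drift hm ha hb hVg hV0 hκ hK hL
  have hlog : ∀ᵐ ω ∂μ, ∀ᶠ t : ℝ≥0 in atTop,
      Real.exp (δ * span (X t ω)) ≤ ((t : ℝ) + 1) ^ 2 := by
    filter_upwards [hX.ae_eventually_lt_sq hm ha hb hVg hV0 hK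
      (fun x hx => (hL x hx).trans (by
        have := mul_nonneg hκ.le (hV0 x); linarith)) hE] with ω hω
    filter_upwards [hω] with t ht using (hfV _).trans ht
  refine ⟨fun i => ?_, fun s _ t => ?_, IsElasticSystem.logarithmicGrowth_of_ae hδ hlog⟩
  · filter_upwards [hlog, hX.ae_tendsto_momentum hm ha hb] with ω h1 h2
    exact tendsto_position_of_span hm hδ h1 h2 i
  · refine (measureReal_le_span_le hδ hfV (hX.integrable_of_hasExpGrowth hm ha hb hVg t)
      (hE t) s).trans (mul_le_mul_of_nonneg_right ?_ (Real.exp_pos _).le)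
    have hs : (0 : ℝ) ≤ span x₀ := by exact_mod_cast span_nonneg x₀
    have h1 := lyapunov_le_exp_span hm hθ.le x₀
    have h2 : Real.exp (θ * (1 + √(massSum m N) * span x₀)) ≤ C * Real.exp (C * span x₀) := by
      rw [mul_add, mul_one, Real.exp_add, ← mul_assoc]
      have h3 : Real.exp θ ≤ C := by
        have := mul_nonneg hθ.le (Real.sqrt_nonneg (massSum m N)); linarith
      have h4 : θ * √(massSum m N) ≤ C := by linarith [Real.exp_pos θ]
      gcongr
    have h5 : K / κ ≤ C := by
      have := mul_nonneg hθ.le (Real.sqrt_nonneg (massSum m N)); linarith [Real.exp_pos θ]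
    linarith

/-- The stability condition is necessary for exponential tails. -/
lemma stabilityCondition_of_exponentialTails [NeZero N] [IsProbabilityMeasure μ]
    (hm : ∀ i, 0 < m i) (ha : ∀ i, 0 ≤ a i) (hb : ∀ i, 0 ≤ b i) (hpos : 0 < ∑ i, (a i + b i))
    (hX : IsElasticSystem m a b x₀ μ X) {C δ : ℝ} (hC : 0 ≤ C) (hδ : 0 < δ)
    (htail : ExponentialTails C δ x₀ μ X) : StabilityCondition m a b := by
  intro k hk1 hkN
  by_contra hcon
  push Not at hcon
  obtain ⟨q, hq, hgen⟩ := exists_le_generator_block_sq hm ha hb hpos hk1 hkN hcon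
  set w : Fin N → ℝ := fun i => blockCoeff m k i * m i with hw
  set f : (Fin N → ℤ) → ℝ := fun x => wsum w x ^ 2 with hf
  have hfg : HasExpGrowth f := hasExpGrowth_wsum_sq w
  have hLg := hasExpGrowth_generator hm ha hb hfg
  have hlower : ∀ t : ℝ≥0, q * t ≤ ∫ ω, f (X t ω) ∂μ := by
    intro t
    rw [hX.dynkin hm ha hb hfg t]
    have h1 : ∫ _ in (0 : ℝ)..t, q ≤
        ∫ s in (0 : ℝ)..t, ∫ ω, generator m a b f (X s.toNNReal ω) ∂μ := by
      refine intervalIntegral.integral_mono_on t.2 (by simp)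
        (hX.intervalIntegrable_of_hasExpGrowth hm ha hb hLg t.2) fun s _ => ?_
      have h2 : ∫ _, q ∂μ ≤ ∫ ω, generator m a b f (X s.toNNReal ω) ∂μ :=
        integral_mono (integrable_const q) (hX.integrable_of_hasExpGrowth hm ha hb hLg _)
          fun ω => hgen _ (hX.ordered _ ω)
      simpa using h2
    rw [intervalIntegral.integral_const, sub_zero, smul_eq_mul, mul_comm] at h1
    have h3 : 0 ≤ f x₀ := sq_nonneg _
    linarith
  set D := C * (1 + Real.exp (C * (span x₀ : ℝ))) with hD
  have hD0 : 0 ≤ D := by positivity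
  set S := ∑' j : ℕ, (2 * (j : ℝ) + 1) * (D * Real.exp (-δ * j)) with hS
  have hS0 : 0 ≤ S := tsum_nonneg fun j => by positivity
  set W := ∑ i, |w i| with hW
  have hupper : ∀ t : ℝ≥0, ∫ ω, f (X t ω) ∂μ ≤ W ^ 2 * S := by
    intro t
    rw [integral_eq_lintegral_of_nonneg_ae (ae_of_all _ fun ω => sq_nonneg _)
      (hX.measurable_comp f t).aestronglyMeasurable]
    refine ENNReal.toReal_le_of_le_ofReal (by positivity) ?_
    calc ∫⁻ ω, ENNReal.ofReal (f (X t ω)) ∂μ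
        ≤ ∫⁻ ω, ENNReal.ofReal (W ^ 2) * ENNReal.ofReal ((span (X t ω) : ℝ) ^ 2) ∂μ := by
          refine lintegral_mono fun ω => ?_
          rw [← ENNReal.ofReal_mul (sq_nonneg _), ← mul_pow]
          refine ENNReal.ofReal_le_ofReal ?_
          have h1 := abs_wsum_le_span (sum_blockCoeff_mass hm k) (X t ω)
          simp only [hf]
          rw [← sq_abs]
          exact pow_le_pow_left₀ (abs_nonneg _) h1 2
      _ = ENNReal.ofReal (W ^ 2) * ∫⁻ ω, ENNReal.ofReal ((span (X t ω) : ℝ) ^ 2) ∂μ :=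
          lintegral_const_mul' _ _ ENNReal.ofReal_ne_top
      _ ≤ ENNReal.ofReal (W ^ 2) * ENNReal.ofReal S :=
          mul_le_mul_right (lintegral_span_sq_le hD0 hδ (hX.stronglyMeasurable t)
            fun s hs => htail s hs t) _
      _ = ENNReal.ofReal (W ^ 2 * S) := (ENNReal.ofReal_mul (sq_nonneg _)).symm
  -- At this time the linear lower bound exceeds the uniform upper bound by one.
  have hT : (0 : ℝ) ≤ (W ^ 2 * S + 1) / q := by positivity
  have h1 := (hlower ((W ^ 2 * S + 1) / q).toNNReal).trans (hupper _)
  rw [Real.coe_toNNReal _ hT, mul_div_cancel₀ _ hq.ne'] at h1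
  linarith

end

end Elastic

end

theorem theorem1 (N : ℕ) [NeZero N] (m a b : Fin N → ℝ)
    (hm : ∀ i, 0 < m i) (ha : ∀ i, 0 ≤ a i) (hb : ∀ i, 0 ≤ b i) :
    -- sufficiency; `C` and `δ` depend only on the parameters `N, m, a, b`
    (Elastic.StabilityCondition m a b →
      ∃ C δ : ℝ, 0 ≤ C ∧ 0 < δ ∧
        ∀ (Ω : Type*) [MeasurableSpace Ω] (μ : Measure Ω) [IsProbabilityMeasure μ]
          (x₀ : Fin N → ℤ) (X : ℝ≥0 → Ω → Fin N → ℤ),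
          Elastic.IsElasticSystem m a b x₀ μ X →
            (∀ i : Fin N, ∀ᵐ ω ∂μ,
              Tendsto (fun t : ℝ≥0 => (X t ω i : ℝ) / (t : ℝ)) atTop
                (𝓝 (-(Elastic.potSum m a b N / Elastic.massSum m N)))) ∧
            Elastic.ExponentialTails C δ x₀ μ X ∧
            Elastic.LogarithmicGrowth μ X) ∧
    -- necessity of the condition for relative stability
    (0 < ∑ i, (a i + b i) →
      ∀ (Ω : Type*) [MeasurableSpace Ω] (μ : Measure Ω) [IsProbabilityMeasure μ]
        (x₀ : Fin N → ℤ) (X : ℝ≥0 → Ω → Fin N → ℤ),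
        Elastic.IsElasticSystem m a b x₀ μ X →
          (∃ C δ : ℝ, 0 ≤ C ∧ 0 < δ ∧ Elastic.ExponentialTails C δ x₀ μ X) →
          Elastic.LogarithmicGrowth μ X →
          Elastic.StabilityCondition m a b) := by
  refine ⟨Elastic.exists_stability_constants hm ha hb, ?_⟩
  rintro hpos Ω _ μ _ x₀ X hX ⟨C, δ, hC, hδ, htail⟩ -
  exact Elastic.stabilityCondition_of_exponentialTails hm ha hb hpos hX hC hδ htail
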